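/- Let $\mathcal C$ be a ribbon fusion category over $\mathbb C$ with braiding $c$ and simple unit. For $d\ge 1$ let $X$ be a $(d,3,1)$-gYBE object with respect to a family $\{X_i\}_{i\in I}$ of $d=|I|$ pairwise non-isomorphic simple objects, i.e. $X\otimes X_i\cong\bigoplus_{j\in I}X_j$ for every $i\in I$. Let $\{Y_k\}$ be a set of representatives of the isomorphism classes of simple objects, and let $V=\mathbb C^I$ with standard basis $(e_i)_{i\in I}$. The spaces $\mathrm{Hom}(X_j,X_i\otimes X)$ are one-dimensional. Choose a nonzero vector in each of them. For all $n\ge 0$, the trees $X_j\to X_i\otimes X^{\otimes n}$ (associated to the left) built from these vertices, with arbitrary internal labels in $I$, form a basis of $\mathrm{Hom}(X_j,X_i\otimes X^{\otimes n})$. Hence $V^{\otimes(n+1)}\cong\bigoplus_{i,j\in I}\mathrm{Hom}(X_j,X_i\otimes X^{\otimes n})$, where $e_{i_0}\otimes\cdots\otimes e_{i_n}$ corresponds to the tree with successive slant labels $i_0,\dots,i_n$. (1) Let $R:V^{\otimes 3}\to V^{\otimes 3}$ be the operator that, under this identification for $n=2$, is the direct sum over $i,j\in I$ of the action of $\mathrm{id}_{X_i}\otimes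 c_{X,X}$ on $\mathrm{Hom}(X_j,X_i\otimes X\otimes X)$. Its $(i,j)$-block in the tree basis is $F^{-1}\bigl(\bigoplus_k R^{XX}_{Y_k}\otimes \mathrm{id}\bigr)F$. Here $R^{XX}_{Y_k}$ is the matrix of $c_{X,X}$ acting on $\mathrm{Hom}(Y_k,X\otimes X)$, the identity is that of $\mathrm{Hom}(X_j,X_i\otimes Y_k)$, and $F$ is the change of basis from the left trees to any basis of right trees $X_j\to X_i\otimes Y_k\to X_i\otimes (X\otimes X)$. Then $R$ is invertible and satisfies the $(d,3,1)$-generalized Yang–Baxter equation $$(R\otimes I_V)(I_V\otimes R)(R\otimes I_V)=(I_V\otimes R)(R\otimes I_V)(I_V\otimes R)\quad\text{on }V^{\otimes 4},$$ and far commutativity $(R\otimes I_V^{\otimes 2})(I_V^{\otimes 2}\otimes R)=(I_V^{\otimes 2}\otimes R)(R\otimes I_V^{\otimes 2})$ on $V^{\otimes 5}$. (2) For every $n$, the assignment $\sigma_p\mapsto I_V^{\otimes(p-1)}\otimes R\otimes I_V^{\otimes(n-p-1)}$ ($1\le p\le n-1$) defines a representation of the braid group $B_n$ on $V^{\otimes(n+1)}$.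 Under the above identification $\sigma_p$ acts by braiding the $p$-th and $(p+1)$-st copies of $X$. Each $\sigma_p$ has at most $\sum_k\dim\mathrm{Hom}(Y_k,X\otimes X)$ distinct eigenvalues. The representation is the direct sum over $i,j\in I$ of the subrepresentations spanned by the $e_{i_0}\otimes\cdots\otimes e_{i_n}$ with $i_0=i$, $i_n=j$; it is not irreducible if $d\ge 2$. (3) The quantum dimension $\dim(X)$ is an integer, and $\dim(X)=d$ whenever $\dim(X)\neq 0$. In particular $\dim(X)=d$ if $X$ is simple, and also if all the $\dim(X_i)$ are positive real numbers (as they are when $\mathcal C$ is unitary). -/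

import Mathlib

open CategoryTheory MonoidalCategory Limits
open scoped TensorProduct Kronecker

universe u w

noncomputable section

namespace GYBE

attribute [local instance] Abelian.hasFiniteBiproducts

/-! ### Tensor powers, the generalized Yang-Baxter equation and far commutativity -/

section TensorPowers

variable {V : Type*} [AddCommGroup V] [Module ℂ V]

/-- `I^{⊗ a} ⊗ R ⊗ I^{⊗ c}` acting on `V^{⊗ N}`, where `a + m + c = N`, for an operator `R` on
`V^{⊗ m}`. -/
def siteOp {m : ℕ} (R : Module.End ℂ (⨂[ℂ]^m V)) (a c : ℕ) {N : ℕ} (h : a + m + c = N) :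
    Module.End ℂ (⨂[ℂ]^N V) :=
  let e : ((⨂[ℂ]^a V) ⊗[ℂ] (⨂[ℂ]^m V)) ⊗[ℂ] (⨂[ℂ]^c V) ≃ₗ[ℂ] ⨂[ℂ]^N V :=
    (TensorProduct.congr TensorPower.mulEquiv (LinearEquiv.refl ℂ (⨂[ℂ]^c V))).trans
      (TensorPower.mulEquiv.trans (TensorPower.cast ℂ V h))
  e.conj (TensorProduct.map (TensorProduct.map LinearMap.id R) LinearMap.id)

/-- `R` is a solution of the `(d,m,1)`-generalized Yang-Baxter equation: `V` has dimension `d` and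
`(R ⊗ I_V)(I_V ⊗ R)(R ⊗ I_V) = (I_V ⊗ R)(R ⊗ I_V)(I_V ⊗ R)` on `V^{⊗ (m+1)}`. -/
structure IsGYBESolution (d m : ℕ) (R : (⨂[ℂ]^m V) ≃ₗ[ℂ] (⨂[ℂ]^m V)) : Prop where
  finite : Module.Finite ℂ V
  finrank_eq : Module.finrank ℂ V = d
  equation :
    siteOp R.toLinearMap 0 1 (N := m + 1) (by omega) *
        siteOp R.toLinearMap 1 0 (N := m + 1) (by omega) *
        siteOp R.toLinearMap 0 1 (N := m + 1) (by omega) =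
      siteOp R.toLinearMap 1 0 (N := m + 1) (by omega) *
        siteOp R.toLinearMap 0 1 (N := m + 1) (by omega) *
        siteOp R.toLinearMap 1 0 (N := m + 1) (by omega)

/-- Far commutativity: for each `j` with `2 < j < m + 1` the operators `R_{σ_1} = R ⊗ I^{⊗ (j-1)}`
and `R_{σ_j} = I^{⊗ (j-1)} ⊗ R` commute on `V^{⊗ (j-1+m)}`. -/
def FarCommutativity (m : ℕ) (R : (⨂[ℂ]^m V) ≃ₗ[ℂ] (⨂[ℂ]^m V)) : Prop :=
  ∀ j : ℕ, 2 < j → j < m + 1 →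
    siteOp R.toLinearMap 0 (j - 1) (N := j - 1 + m) (by omega) *
        siteOp R.toLinearMap (j - 1) 0 (N := j - 1 + m) (by omega) =
      siteOp R.toLinearMap (j - 1) 0 (N := j - 1 + m) (by omega) *
        siteOp R.toLinearMap 0 (j - 1) (N := j - 1 + m) (by omega)

end TensorPowers

/-- The basis vector `e_{s 0} ⊗ e_{s 1} ⊗ ⋯` of `V^{⊗ N}`, where `V = ℂ^ι`. -/
def wordVec {ι : Type*} [DecidableEq ι] {N : ℕ} (s : Fin N → ι) : ⨂[ℂ]^N (ι → ℂ) :=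
  PiTensorProduct.tprod ℂ fun q => (Pi.single (s q) 1 : ι → ℂ)

/-- The span of the basis vectors of `V^{⊗ (n+1)}` with first letter `i` and last letter `j`. -/
def wordSpan {ι : Type*} [DecidableEq ι] (n : ℕ) (i j : ι) : Submodule ℂ (⨂[ℂ]^(n + 1) (ι → ℂ)) :=
  Submodule.span ℂ {x | ∃ s : Fin (n + 1) → ι, s 0 = i ∧ s (Fin.last n) = j ∧ x = wordVec s}

/-! ### Braid groups -/

/-- The relations of the braid group on `n` strands; the generator `p : Fin (n - 1)` is
`σ_{p+1}`. -/
inductive BraidRel (n : ℕ) : FreeGroup (Fin (n - 1)) → Prop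
  | braid (p q : Fin (n - 1)) (h : p.val + 1 = q.val) :
      BraidRel n (FreeGroup.of p * FreeGroup.of q * FreeGroup.of p *
        (FreeGroup.of q * FreeGroup.of p * FreeGroup.of q)⁻¹)
  | far (p q : Fin (n - 1)) (h : p.val + 1 < q.val) :
      BraidRel n (FreeGroup.of p * FreeGroup.of q * (FreeGroup.of q * FreeGroup.of p)⁻¹)

/-- Artin's braid group on `n` strands. -/
abbrev BraidGroup (n : ℕ) : Type := PresentedGroup {r | BraidRel n r}

/-- The standard generators of the braid group. -/
def braidGen {n : ℕ} (p : Fin (n - 1)) : BraidGroup n := PresentedGroup.of p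

/-! ### Ribbon fusion categories -/

/-- A fusion category over `ℂ`: a `ℂ`-linear abelian rigid monoidal category with bilinear tensor
product that is semisimple with finitely many simple objects up to isomorphism,
finite-dimensional morphism spaces and simple unit. -/
class FusionCategory (C : Type u) [Category.{w} C] [Abelian C] [Linear ℂ C] [MonoidalCategory C]
    [MonoidalPreadditive C] [MonoidalLinear ℂ C] [RigidCategory C] : Prop where
  simple_unit : Simple (𝟙_ C)
  finite_hom : ∀ A B : C, FiniteDimensional ℂ (A ⟶ B)
  semisimple : ∀ A : C, ∃ (n : ℕ) (f : Fin n → C),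
    (∀ i, Simple (f i)) ∧ Nonempty (A ≅ ⨁ f)
  finite_simples : ∃ (n : ℕ) (f : Fin n → C), ∀ A : C, Simple A → ∃ i, Nonempty (A ≅ f i)

/-- A ribbon structure on a braided rigid category: a twist compatible with tensor products and
duals. -/
class RibbonStructure (C : Type u) [Category.{w} C] [MonoidalCategory C] [BraidedCategory C]
    [RigidCategory C] where
  twist : ∀ A : C, A ≅ A
  twist_naturality : ∀ {A B : C} (f : A ⟶ B), f ≫ (twist B).hom = (twist A).hom ≫ f
  twist_tensor : ∀ A B : C, (twist (A ⊗ B)).hom =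
    (β_ A B).hom ≫ (β_ B A).hom ≫ ((twist A).hom ⊗ₘ (twist B).hom)
  twist_dual : ∀ A : C, (twist (Aᘁ)).hom = rightAdjointMate (twist A).hom

section Dimension

variable {C : Type u} [Category.{w} C] [Abelian C] [Linear ℂ C] [MonoidalCategory C]
  [MonoidalPreadditive C] [MonoidalLinear ℂ C] [RigidCategory C] [FusionCategory C]

theorem exists_scalar (f : 𝟙_ C ⟶ 𝟙_ C) : ∃ z : ℂ, z • 𝟙 (𝟙_ C) = f := by
  have : Simple (𝟙_ C) := FusionCategory.simple_unit
  have : FiniteDimensional ℂ (𝟙_ C ⟶ 𝟙_ C) := FusionCategory.finite_hom _ _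
  exact endomorphism_simple_eq_smul_id ℂ f

variable [BraidedCategory C] [RibbonStructure C]

/-- The quantum trace of the identity of `A`, an endomorphism of the unit object. -/
def quantumTraceId (A : C) : 𝟙_ C ⟶ 𝟙_ C :=
  η_ A (Aᘁ) ≫ (RibbonStructure.twist A).hom ▷ (Aᘁ) ≫ (β_ A (Aᘁ)).hom ≫ ε_ A (Aᘁ)

/-- The quantum dimension: the scalar `z` with `quantumTraceId A = z • 𝟙`. -/
def qdim (A : C) : ℂ := (exists_scalar (quantumTraceId A)).choose

end Dimension

/-! ### gYBE objects -/

/-- `X` is a `(d,3,1)`-gYBE object with respect to the family `S` of `d` pairwise non-isomorphic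
simple objects. -/
structure IsGYBEObject {C : Type u} [Category.{w} C] [Abelian C] [MonoidalCategory C]
    {ι : Type*} [Fintype ι] (d : ℕ) (X : C) (S : ι → C) : Prop where
  card_eq : Fintype.card ι = d
  simple : ∀ i, Simple (S i)
  distinct : ∀ i j, Nonempty (S i ≅ S j) → i = j
  fusion : ∀ i, Nonempty (X ⊗ S i ≅ ⨁ S)

/-- `Y` is a representative family of the isomorphism classes of simple objects. -/
structure IsSimpleRepresentatives {C : Type u} [Category.{w} C] [Abelian C] {κ : Type*}
    (Y : κ → C) : Prop where
  simple : ∀ k, Simple (Y k)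
  exists_unique : ∀ A : C, Simple A → ∃! k, Nonempty (A ≅ Y k)

/-! ### Tree bases and the action of braids by stacking -/

section Trees

variable {C : Type u} [Category.{w} C] [MonoidalCategory C]

/-- `A ⊗ X^{⊗ n}`, associated to the left. -/
def leftPow (A X : C) : ℕ → C
  | 0 => A
  | n + 1 => leftPow A X n ⊗ X

/-- The tree with two `X`-strands, bottom label `j`, top label `i` and internal label `k`, with
vertices `v`. -/
def leftTree {ι : Type*} {S : ι → C} {X : C} (v : ∀ i j, S j ⟶ S i ⊗ X) (i k j : ι) :
    S j ⟶ (S i ⊗ X) ⊗ X :=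
  v k j ≫ v i k ▷ X

/-- The tree in which the two `X`-strands fuse first to `B`. -/
def rightTree {A B X D : C} (f : D ⟶ A ⊗ B) (y : B ⟶ X ⊗ X) : D ⟶ (A ⊗ X) ⊗ X :=
  f ≫ A ◁ y ≫ (α_ A X X).inv

/-- The tree whose slant edges are labeled by the word `s`, of length `n + 1`; its top label is
`s 0` and its bottom label is the last letter. -/
def wordTree {ι : Type*} {S : ι → C} {X : C} (v : ∀ i j, S j ⟶ S i ⊗ X) :
    ∀ (n : ℕ) (s : Fin (n + 1) → ι), S (s (Fin.last n)) ⟶ leftPow (S (s 0)) X n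
  | 0, _ => 𝟙 _
  | n + 1, s =>
    v (s (Fin.last n).castSucc) (s (Fin.last (n + 1))) ≫
      wordTree v n (fun q => s q.castSucc) ▷ X

variable [BraidedCategory C]

/-- The braiding of the two `X`-strands on `(A ⊗ X) ⊗ X`. -/
def braidTop (A X : C) : (A ⊗ X) ⊗ X ⟶ (A ⊗ X) ⊗ X :=
  (α_ A X X).hom ≫ A ◁ (β_ X X).hom ≫ (α_ A X X).inv

/-- The braiding of the `X`-strands number `p` and `p + 1` (counted from `0`) on `A ⊗ X^{⊗ n}`,
where `p + 1 < n`. -/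
def stackBraid (A X : C) : ∀ (n _p : ℕ), leftPow A X n ⟶ leftPow A X n
  | 0, _ => 𝟙 _
  | 1, _ => 𝟙 _
  | n + 2, p =>
    if p = n then braidTop (leftPow A X n) X else stackBraid A X (n + 1) p ▷ X

/-- The linear operator on `Hom(B, X ⊗ X)` given by the braiding. -/
def braidingOp [Preadditive C] [Linear ℂ C] (B X : C) : Module.End ℂ (B ⟶ X ⊗ X) :=
  Linear.rightComp ℂ B (β_ X X).hom

end Trees

end GYBE

end

/-! All claims about `R` are proved on the other side of the tree isomorphism. Let H_n be the sum
over i, j of Hom(S j, S i ⊗ X^{⊗n}). Braiding strands of X acts on H_n by postcomposition; there the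
braid relation is the categorical Yang–Baxter identity whiskered by the lower strands, and far
commutativity is the interchange law.

Two facts carry this back to words. Trees form a basis of H_n: dual vertices assemble into cotrees,
which are orthogonal to trees (`treeFamily_comp_cotree`) and resolve the identity
(`sum_cotree_comp_treeFamily`). And braiding is local in the labels: braiding strands p and p + 1,
counted from 0, changes only letter p + 1, with coefficients that depend on its two neighbours
(`treeFamily_comp_stackBraid`). This is how I ⊗ R ⊗ I acts on words, so `intertwines_siteOp`
transports every relation. Postcomposition never mixes different i or j, whence the invariant
blocks. An eigenvalue z of a generator must occur on some Hom(Y_k, X ⊗ X), for otherwise c - z, and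
with it c - z applied to two strands, is invertible.

For the dimension, `qdim` is additive and multiplicative, so dim X · dim X_i = D for all i, where D
is the sum of the dim X_j. Summing over i gives dim X · D = d · D. As simple objects have nonzero
dimension, dim X ≠ 0 forces D ≠ 0 and dim X = d. Multiplicativity rests on `braidedEval_tensor`,
where the double braiding contributed by the twist of a tensor product is absorbed. -/

set_option linter.unusedSectionVars false

noncomputable section

namespace GYBE

attribute [local instance] Abelian.hasFiniteBiproducts

/-! ### Traces in braided categories -/

section BraidedTrace

variable {C : Type u} [Category.{w} C] [MonoidalCategory C] [BraidedCategory C]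

/-- The evaluation `A ⊗ A' ⟶ 𝟙_ C` obtained from `ε_ A A'` by braiding. -/
def braidedEval (A A' : C) [ExactPairing A A'] : A ⊗ A' ⟶ 𝟙_ C := (β_ A A').hom ≫ ε_ A A'

/-- A strand `W` slides through the cap `e`: the braiding is natural in `e`, and braiding with the
unit is trivial. The next two lemmas are the same move for other crossings. -/
theorem braiding_comp_whiskerLeft_form {A A' : C} (e : A ⊗ A' ⟶ 𝟙_ C) (W : C) :
    (β_ A W).hom ▷ A' ⊗≫ W ◁ e =
      𝟙 _ ⊗≫ A ◁ (β_ A' W).inv ⊗≫ e ▷ W ⊗≫ 𝟙 (W ⊗ 𝟙_ C) := by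
  have h := BraidedCategory.braiding_naturality_left e W
  rw [BraidedCategory.braiding_tensor_left_hom, braiding_tensorUnit_left] at h
  calc
    _ = 𝟙 _ ⊗≫ A ◁ ((β_ A' W).inv ≫ (β_ A' W).hom) ⊗≫ (β_ A W).hom ▷ A' ⊗≫ W ◁ e := by
      rw [Iso.inv_hom_id]; monoidal
    _ = 𝟙 _ ⊗≫ A ◁ (β_ A' W).inv ⊗≫ (((α_ A A' W).hom ≫ A ◁ (β_ A' W).hom ≫ (α_ A W A').inv ≫
          (β_ A W).hom ▷ A' ≫ (α_ W A A').hom) ≫ W ◁ e) := by monoidal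
    _ = _ := by rw [← h]; monoidal

theorem whiskerRight_form_braiding {A A' : C} (e : A ⊗ A' ⟶ 𝟙_ C) (W : C) :
    (β_ W A).hom ▷ A' ⊗≫ A ◁ (β_ W A').hom ⊗≫ e ▷ W =
      𝟙 _ ⊗≫ W ◁ e ⊗≫ 𝟙 (𝟙_ C ⊗ W) := by
  have h := BraidedCategory.braiding_naturality_right W e
  rw [BraidedCategory.braiding_tensor_right_hom, braiding_tensorUnit_right] at h
  calc
    _ = 𝟙 _ ⊗≫ (((α_ W A A').inv ≫ (β_ W A).hom ▷ A' ≫ (α_ A W A').hom ≫ A ◁ (β_ W A').hom ≫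
          (α_ A A' W).inv) ≫ e ▷ W) := by monoidal
    _ = _ := by rw [← h]; monoidal

theorem whiskerLeft_braiding_inv_form {B B' : C} (e : B ⊗ B' ⟶ 𝟙_ C) (W : C) :
    B ◁ (β_ W B').inv ⊗≫ (β_ W B).inv ▷ B' ⊗≫ W ◁ e =
      𝟙 _ ⊗≫ e ▷ W ⊗≫ 𝟙 (W ⊗ 𝟙_ C) := by
  have h := BraidedCategory.braiding_inv_naturality_left e W
  rw [BraidedCategory.braiding_tensor_right_inv, braiding_inv_tensorUnit_right] at h
  calc
    _ = 𝟙 _ ⊗≫ (((α_ B B' W).hom ≫ B ◁ (β_ W B').inv ≫ (α_ B W B').inv ≫ (β_ W B).inv ▷ B' ≫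
          (α_ W B B').hom) ≫ W ◁ e) := by monoidal
    _ = _ := by rw [← h]; monoidal

/-- The caps of `A` and `B` are linked in the evaluation of `A ⊗ B`; the double braiding unlinks
them, so they become nested and the inner one can be evaluated first. -/
theorem braidedEval_tensor (A A' B B' : C) [ExactPairing A A'] [ExactPairing B B'] :
    ((β_ A B).hom ≫ (β_ B A).hom) ▷ (B' ⊗ A') ≫ braidedEval (A ⊗ B) (B' ⊗ A') =
      𝟙 _ ⊗≫ A ◁ braidedEval B B' ▷ A' ⊗≫ braidedEval A A' := by
  -- The two caps are put side by side, at the price of crossing `A'` past `B'` and `B`. The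
  -- remaining crossings then slide off the caps.
  have h1 : braidedEval (A ⊗ B) (B' ⊗ A') = 𝟙 _ ⊗≫ A ◁ B ◁ (β_ A' B').inv ⊗≫
      A ◁ (β_ B A').hom ▷ B' ⊗≫ braidedEval A A' ▷ (B ⊗ B') ⊗≫ braidedEval B B' := by
    calc
      _ = 𝟙 _ ⊗≫ A ◁ (β_ B (B' ⊗ A')).hom ⊗≫
          ((β_ A B').hom ▷ A' ⊗≫ B' ◁ braidedEval A A') ▷ B ⊗≫ ε_ B B' := by
        unfold braidedEval
        rw [ExactPairing.tensor_evaluation, BraidedCategory.braiding_tensor_left_hom,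
          BraidedCategory.braiding_tensor_right_hom A B' A']
        monoidal
      _ = 𝟙 _ ⊗≫ A ◁ ((β_ B (B' ⊗ A')).hom ≫ (β_ A' B').inv ▷ B) ⊗≫
          (braidedEval A A' ▷ (B' ⊗ B) ≫ (𝟙_ C) ◁ ε_ B B') ⊗≫ 𝟙 _ := by
        rw [braiding_comp_whiskerLeft_form]
        monoidal
      _ = 𝟙 _ ⊗≫ A ◁ B ◁ (β_ A' B').inv ⊗≫ A ◁ (β_ B A').hom ▷ B' ⊗≫
          (A ⊗ A') ◁ (β_ B B').hom ⊗≫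
          (braidedEval A A' ▷ (B' ⊗ B) ≫ (𝟙_ C) ◁ ε_ B B') ⊗≫ 𝟙 _ := by
        rw [← BraidedCategory.braiding_naturality_right,
          BraidedCategory.braiding_tensor_right_hom]
        monoidal
      _ = 𝟙 _ ⊗≫ A ◁ B ◁ (β_ A' B').inv ⊗≫ A ◁ (β_ B A').hom ▷ B' ⊗≫
          ((A ⊗ A') ◁ (β_ B B').hom ≫ braidedEval A A' ▷ (B' ⊗ B)) ⊗≫ ε_ B B' := by
        monoidal
      _ = _ := by
        rw [whisker_exchange]
        unfold braidedEval
        monoidal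
  calc
    _ = 𝟙 _ ⊗≫ (β_ A B).hom ▷ (B' ⊗ A') ⊗≫ ((β_ B A).hom ▷ (B' ⊗ A') ≫
        (A ⊗ B) ◁ (β_ A' B').inv) ⊗≫ A ◁ (β_ B A').hom ▷ B' ⊗≫ braidedEval A A' ▷ (B ⊗ B') ⊗≫
        braidedEval B B' := by
      rw [h1]; monoidal
    _ = 𝟙 _ ⊗≫ ((β_ A B).hom ▷ (B' ⊗ A') ≫ (B ⊗ A) ◁ (β_ A' B').inv) ⊗≫
        ((β_ B A).hom ▷ A' ⊗≫ A ◁ (β_ B A').hom ⊗≫ braidedEval A A' ▷ B) ▷ B' ⊗≫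
        braidedEval B B' := by
      rw [← whisker_exchange]; monoidal
    _ = 𝟙 _ ⊗≫ (A ⊗ B) ◁ (β_ A' B').inv ⊗≫
        ((β_ A B).hom ▷ A' ⊗≫ B ◁ braidedEval A A') ▷ B' ⊗≫
        braidedEval B B' := by
      rw [whiskerRight_form_braiding, ← whisker_exchange]; monoidal
    _ = 𝟙 _ ⊗≫ (A ⊗ B) ◁ (β_ A' B').inv ⊗≫ A ◁ (β_ A' B).inv ▷ B' ⊗≫
        (braidedEval A A' ▷ (B ⊗ B') ≫ (𝟙_ C) ◁ braidedEval B B') ⊗≫ 𝟙 _ := by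
      rw [braiding_comp_whiskerLeft_form]; monoidal
    _ = 𝟙 _ ⊗≫ A ◁ (B ◁ (β_ A' B').inv ⊗≫ (β_ A' B).inv ▷ B' ⊗≫ A' ◁ braidedEval B B') ⊗≫
        braidedEval A A' := by
      rw [← whisker_exchange]; monoidal
    _ = _ := by
      rw [whiskerLeft_braiding_inv_form]; monoidal

/-- The trace `𝟙_ C ⟶ A ⊗ A' ⟶ 𝟙_ C` of an endomorphism. -/
def braidedTrace (A A' : C) [ExactPairing A A'] (f : A ⟶ A) : 𝟙_ C ⟶ 𝟙_ C :=
  η_ A A' ≫ f ▷ A' ≫ braidedEval A A'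

/-- Cyclicity: `f` travels around the loop as its mate, through the coevaluation, the braiding and
the evaluation. -/
theorem braidedTrace_comp_comm_of_dual {A B : C} [HasRightDual A] [HasRightDual B] (f : A ⟶ B)
    (g : B ⟶ A) : braidedTrace A Aᘁ (f ≫ g) = braidedTrace B Bᘁ (g ≫ f) := by
  unfold braidedTrace braidedEval
  rw [comp_whiskerRight, Category.assoc, ← coevaluation_comp_rightAdjointMate_assoc,
    whisker_exchange_assoc, BraidedCategory.braiding_naturality_right_assoc,
    rightAdjointMate_comp_evaluation, comp_whiskerRight, Category.assoc,
    BraidedCategory.braiding_naturality_left_assoc]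
  simp

/-- The duals here are arbitrary. With `f` an identity, the trace is seen not to depend on the
chosen dual, which later trades `(A ⊗ B)ᘁ` for `Bᘁ ⊗ Aᘁ`. -/
theorem braidedTrace_comp_comm {A A' B B' : C} [p : ExactPairing A A'] [q : ExactPairing B B']
    (f : A ⟶ B) (g : B ⟶ A) : braidedTrace A A' (f ≫ g) = braidedTrace B B' (g ≫ f) :=
  @braidedTrace_comp_comm_of_dual C _ _ _ A B ⟨A'⟩ ⟨B'⟩ f g

/-- Once the caps are nested, the loop of `B` closes up inside that of `A` and becomes an
endomorphism of the unit. -/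
theorem braidedTrace_tensor_twist {A A' B B' : C} [ExactPairing A A'] [ExactPairing B B']
    (f : A ⟶ A) (g : B ⟶ B) :
    braidedTrace (A ⊗ B) (B' ⊗ A') ((f ⊗ₘ g) ≫ (β_ A B).hom ≫ (β_ B A).hom) =
      η_ A A' ≫ (f ▷ A' ≫ (A ◁ ((λ_ A').inv ≫ braidedTrace B B' g ▷ A' ≫ (λ_ A').hom))) ≫
        braidedEval A A' := by
  unfold braidedTrace
  rw [comp_whiskerRight, Category.assoc, braidedEval_tensor, ExactPairing.tensor_coevaluation]
  calc
    _ = 𝟙 _ ⊗≫ η_ A A' ⊗≫ A ◁ η_ B B' ▷ A' ⊗≫ f ▷ (B ⊗ B') ▷ A' ⊗≫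
        A ◁ g ▷ B' ▷ A' ⊗≫ A ◁ braidedEval B B' ▷ A' ⊗≫ braidedEval A A' := by
      rw [MonoidalCategory.tensorHom_def]; monoidal
    _ = 𝟙 _ ⊗≫ η_ A A' ⊗≫ (A ◁ η_ B B' ≫ f ▷ (B ⊗ B')) ▷ A' ⊗≫
        A ◁ g ▷ B' ▷ A' ⊗≫ A ◁ braidedEval B B' ▷ A' ⊗≫ braidedEval A A' := by
      monoidal
    _ = _ := by
      rw [whisker_exchange]
      monoidal

end BraidedTrace

/-! ### Consequences of semisimplicity -/

section Semisimple

variable {C : Type u} [Category.{w} C] [Abelian C] [Linear ℂ C] [MonoidalCategory C]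
  [MonoidalPreadditive C] [MonoidalLinear ℂ C] [RigidCategory C] [FusionCategory C]

theorem finiteDimensional_hom (A B : C) : FiniteDimensional ℂ (A ⟶ B) :=
  FusionCategory.finite_hom A B

attribute [local instance] finiteDimensional_hom

theorem exists_simple_decomposition (A : C) : ∃ (n : ℕ) (g : Fin n → C) (p : ∀ t, g t ⟶ A)
    (q : ∀ t, A ⟶ g t), (∀ t, Simple (g t)) ∧ ∑ t, q t ≫ p t = 𝟙 A := by
  obtain ⟨n, g, hg, ⟨e⟩⟩ := FusionCategory.semisimple A
  refine ⟨n, g, fun t => biproduct.ι g t ≫ e.inv, fun t => e.hom ≫ biproduct.π g t, hg, ?_⟩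
  have h : ∑ t, biproduct.π g t ≫ biproduct.ι g t = 𝟙 (⨁ g) :=
    IsBilimit.total (biproduct.isBilimit _)
  have h' := congrArg (fun x => e.hom ≫ x ≫ e.inv) h
  simpa only [Preadditive.comp_sum, Preadditive.sum_comp, Category.assoc, Category.id_comp,
    Iso.hom_inv_id] using h'

theorem exists_smul_iso_hom {A B : C} [Simple A] (e : A ≅ B) (f : A ⟶ B) :
    ∃ z : ℂ, f = z • e.hom := by
  obtain ⟨z, hz⟩ := endomorphism_simple_eq_smul_id ℂ (f ≫ e.inv)
  refine ⟨z, ?_⟩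
  rw [← cancel_mono e.inv, ← hz]
  simp

theorem exists_retraction {A Z : C} [Simple A] {f : A ⟶ Z} (hf : f ≠ 0) :
    ∃ r : Z ⟶ A, f ≫ r = 𝟙 A := by
  obtain ⟨n, g, p, q, hg, h⟩ := exists_simple_decomposition Z
  have ⟨t, ht⟩ : ∃ t, f ≫ q t ≠ 0 := by
    by_contra! hq
    apply hf
    rw [← Category.comp_id f, ← h, Preadditive.comp_sum]
    refine Finset.sum_eq_zero fun t _ => ?_
    rw [← Category.assoc, hq, zero_comp]
  have := isIso_of_hom_simple ht
  exact ⟨q t ≫ inv (f ≫ q t), by rw [← Category.assoc, IsIso.hom_inv_id]⟩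

/-- Nondegeneracy of the composition pairing Hom(A, Z) × Hom(Z, A) → End A = ℂ, by Schur's lemma on
each simple summand of `Z`. -/
theorem exists_hom_representing {A : C} [Simple A] {Z : C} (φ : (A ⟶ Z) →ₗ[ℂ] ℂ) :
    ∃ h : Z ⟶ A, ∀ f : A ⟶ Z, f ≫ h = φ f • 𝟙 A := by
  obtain ⟨n, g, p, q, hg, hpq⟩ := exists_simple_decomposition Z
  have key : ∀ t, ∃ h : g t ⟶ A, ∀ f : A ⟶ g t, f ≫ h = φ (f ≫ p t) • 𝟙 A := by
    intro t
    by_cases ht : Nonempty (A ≅ g t)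
    · obtain ⟨e⟩ := ht
      refine ⟨φ (e.hom ≫ p t) • e.inv, fun f => ?_⟩
      obtain ⟨z, rfl⟩ := exists_smul_iso_hom e f
      simp [smul_smul, mul_comm]
    · refine ⟨0, fun f => ?_⟩
      have hf : f = 0 := by
        by_contra hf
        have := isIso_of_hom_simple hf
        exact ht ⟨asIso f⟩
      simp [hf]
  choose h hh using key
  refine ⟨∑ t, q t ≫ h t, fun f => ?_⟩
  calc
    _ = ∑ t, (f ≫ q t) ≫ h t := by simp [Preadditive.comp_sum]
    _ = φ (∑ t, f ≫ q t ≫ p t) • 𝟙 A := by simp only [hh, map_sum, Finset.sum_smul, Category.assoc]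
    _ = _ := by rw [← Preadditive.comp_sum, hpq, Category.comp_id]

theorem hom_eq_zero_of_not_iso {A B : C} [Simple A] [Simple B] (h : ¬ Nonempty (A ≅ B))
    (f : A ⟶ B) : f = 0 := by
  by_contra hf
  have := isIso_of_hom_simple hf
  exact h ⟨asIso f⟩

/-- The coordinate functionals of `b` are represented by morphisms out of `Z`. The resulting
resolution of the identity may be tested on simple subobjects, where it is the expansion in the
basis `b k`. -/
theorem exists_dual_basis {κ σ : Type*} [Fintype κ] [Fintype σ] {Y : κ → C}
    (hY : ∀ k, Simple (Y k)) (hdist : ∀ k l, Nonempty (Y k ≅ Y l) → k = l) {Z : C} {g : σ → C}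
    (p : ∀ t, g t ⟶ Z) (q : ∀ t, Z ⟶ g t) (hpq : ∑ t, q t ≫ p t = 𝟙 Z)
    (hg : ∀ t, ∃ k, Nonempty (Y k ≅ g t)) {a : κ → Type*} [∀ k, Fintype (a k)]
    [∀ k, DecidableEq (a k)] (b : ∀ k, Module.Basis (a k) ℂ (Y k ⟶ Z)) :
    ∃ b' : ∀ k, a k → (Z ⟶ Y k), (∀ k r s, b k r ≫ b' k s = if r = s then 𝟙 (Y k) else 0) ∧
      ∑ k, ∑ r, b' k r ≫ b k r = 𝟙 Z := by
  have key : ∀ k s, ∃ h : Z ⟶ Y k, ∀ f : Y k ⟶ Z, f ≫ h = (b k).coord s f • 𝟙 (Y k) :=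
    fun k s => exists_hom_representing _
  choose b' hb' using key
  refine ⟨b', fun k r s => ?_, ?_⟩
  · rw [hb', Module.Basis.coord_apply, Module.Basis.repr_self, Finsupp.single_apply]
    split_ifs <;> simp
  · have main : ∀ k (f : Y k ⟶ Z), f ≫ ∑ k, ∑ r, b' k r ≫ b k r = f := by
      intro k f
      rw [Preadditive.comp_sum, Finset.sum_eq_single k]
      · simp only [Preadditive.comp_sum, ← Category.assoc, hb', Linear.smul_comp, Category.id_comp,
          Module.Basis.coord_apply]
        exact (b k).sum_repr f
      · intro l _ hl
        refine (Preadditive.comp_sum ..).trans (Finset.sum_eq_zero fun r _ => ?_)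
        rw [← Category.assoc, hom_eq_zero_of_not_iso (fun h => hl (hdist _ _ h).symm) (f ≫ b' l r),
          zero_comp]
      · simp
    rw [← Category.id_comp (∑ k, _), ← hpq, Preadditive.sum_comp]
    refine Finset.sum_congr rfl fun t _ => ?_
    obtain ⟨k, ⟨e⟩⟩ := hg t
    have h := main k (e.hom ≫ p t)
    rw [Category.assoc, cancel_epi] at h
    rw [Category.assoc, h]

theorem mono_of_forall_simple {κ : Type*} {Y : κ → C} (hY : IsSimpleRepresentatives Y) {Z W : C}
    (m : Z ⟶ W) (h : ∀ k (f : Y k ⟶ Z), f ≫ m = 0 → f = 0) : Mono m := by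
  refine Preadditive.mono_of_cancel_zero _ fun {A} f hf => ?_
  obtain ⟨n, g, p, q, hg, hpq⟩ := exists_simple_decomposition A
  rw [← Category.id_comp f, ← hpq, Preadditive.sum_comp]
  refine Finset.sum_eq_zero fun t _ => ?_
  obtain ⟨k, ⟨e⟩, -⟩ := hY.exists_unique (g t) (hg t)
  have := h k (e.inv ≫ p t ≫ f) (by simp [hf])
  have h2 : p t ≫ f = 0 := by rw [← cancel_epi e.inv, this, comp_zero]
  rw [Category.assoc, h2, comp_zero]

/-- Composition with `m` is injective on the finite-dimensional space End Z, hence surjective, and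
so hits the identity. -/
theorem isIso_of_mono_endomorphism {Z : C} (m : Z ⟶ Z) [Mono m] : IsIso m := by
  have hinj : Function.Injective (Linear.rightComp ℂ Z m) := by
    intro f g h
    exact (cancel_mono m).1 h
  obtain ⟨r, hr⟩ := (LinearMap.injective_iff_surjective.1 hinj) (𝟙 Z)
  have hr' : r ≫ m = 𝟙 Z := hr
  exact ⟨r, by rw [← cancel_mono m, Category.assoc, hr']; simp, hr'⟩

end Semisimple

/-! ### Quantum dimensions -/

section QuantumDimension

variable {C : Type u} [Category.{w} C] [Abelian C] [Linear ℂ C] [MonoidalCategory C]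
  [MonoidalPreadditive C] [MonoidalLinear ℂ C] [RigidCategory C] [FusionCategory C]
  [BraidedCategory C] [RibbonStructure C]

attribute [local instance] finiteDimensional_hom

theorem qdim_smul_id (A : C) : qdim A • 𝟙 (𝟙_ C) = quantumTraceId A :=
  (exists_scalar (quantumTraceId A)).choose_spec

theorem id_unit_ne_zero : 𝟙 (𝟙_ C) ≠ 0 := by
  have : Simple (𝟙_ C) := FusionCategory.simple_unit
  exact id_nonzero _

theorem qdim_eq_of_smul_id {A : C} {z : ℂ} (h : quantumTraceId A = z • 𝟙 (𝟙_ C)) :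
    qdim A = z :=
  smul_left_injective ℂ id_unit_ne_zero ((qdim_smul_id A).trans h)

theorem quantumTraceId_eq (A : C) :
    quantumTraceId A = braidedTrace A Aᘁ (RibbonStructure.twist A).hom := rfl

theorem braidedTrace_sum {A A' : C} [ExactPairing A A'] {σ : Type*} (s : Finset σ)
    (f : σ → (A ⟶ A)) : braidedTrace A A' (∑ t ∈ s, f t) = ∑ t ∈ s, braidedTrace A A' (f t) := by
  simp only [braidedTrace, sum_whiskerRight, Preadditive.comp_sum, Preadditive.sum_comp]

theorem braidedTrace_comp_twist_comm {A A' B B' : C} [ExactPairing A A'] [ExactPairing B B']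
    (f : A ⟶ B) (g : B ⟶ A) :
    braidedTrace A A' (f ≫ g ≫ (RibbonStructure.twist A).hom) =
      braidedTrace B B' (g ≫ f ≫ (RibbonStructure.twist B).hom) := by
  rw [braidedTrace_comp_comm (B' := B'), Category.assoc, RibbonStructure.twist_naturality]

theorem qdim_congr {A B : C} (e : A ≅ B) : qdim A = qdim B := by
  apply qdim_eq_of_smul_id
  rw [qdim_smul_id, quantumTraceId_eq, quantumTraceId_eq]
  simpa using braidedTrace_comp_twist_comm e.hom e.inv (A' := Aᘁ) (B' := Bᘁ)

theorem qdim_biproduct {σ : Type*} [Fintype σ] (g : σ → C) : qdim (⨁ g) = ∑ t, qdim (g t) := by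
  classical
  apply qdim_eq_of_smul_id
  have h : ∑ t, biproduct.π g t ≫ biproduct.ι g t = 𝟙 (⨁ g) :=
    IsBilimit.total (biproduct.isBilimit _)
  rw [Finset.sum_smul, quantumTraceId_eq, ← Category.id_comp (RibbonStructure.twist _).hom,
    ← h, Preadditive.sum_comp, braidedTrace_sum]
  refine Finset.sum_congr rfl fun t _ => ?_
  rw [qdim_smul_id, Category.assoc, braidedTrace_comp_twist_comm (B' := (g t)ᘁ)]
  simp [quantumTraceId_eq]

theorem qdim_tensor (A B : C) : qdim (A ⊗ B) = qdim A * qdim B := by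
  apply qdim_eq_of_smul_id
  have h := braidedTrace_comp_comm (A' := (A ⊗ B)ᘁ) (B' := Bᘁ ⊗ Aᘁ) (𝟙 (A ⊗ B))
    (RibbonStructure.twist (A ⊗ B)).hom
  rw [Category.id_comp, Category.comp_id] at h
  have h2 : (RibbonStructure.twist (A ⊗ B)).hom = ((RibbonStructure.twist A).hom ⊗ₘ
      (RibbonStructure.twist B).hom) ≫ (β_ A B).hom ≫ (β_ B A).hom := by
    rw [RibbonStructure.twist_tensor, BraidedCategory.braiding_naturality_assoc,
      BraidedCategory.braiding_naturality]
  rw [quantumTraceId_eq, h, h2, braidedTrace_tensor_twist, ← quantumTraceId_eq B, ← qdim_smul_id B,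
    mul_comm, mul_smul, qdim_smul_id A, quantumTraceId_eq]
  simp [braidedTrace]

/-- By duality Hom(A* ⊗ A, 1) ≅ Hom(A, A ⊗ 1), which is one-dimensional by Schur's lemma. -/
theorem eq_smul_evaluation {A : C} [Simple A] (r : Aᘁ ⊗ A ⟶ 𝟙_ C) :
    ∃ z : ℂ, r = z • ε_ A Aᘁ := by
  obtain ⟨z, hz⟩ := exists_smul_iso_hom (ρ_ A).symm (tensorLeftHomEquiv A A Aᘁ (𝟙_ C) r)
  refine ⟨z, ?_⟩
  rw [← Equiv.symm_apply_apply (tensorLeftHomEquiv A A Aᘁ (𝟙_ C)) r, hz]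
  simp [tensorLeftHomEquiv, unitors_equal]

theorem qdim_ne_zero_of_simple (A : C) [Simple A] : qdim A ≠ 0 := by
  have : Simple (𝟙_ C) := FusionCategory.simple_unit
  have hη : η_ A Aᘁ ≠ 0 := by
    intro h
    have h1 := ExactPairing.evaluation_coevaluation A Aᘁ
    rw [h] at h1
    apply id_nonzero A
    rw [← cancel_epi (λ_ A).hom, ← cancel_mono (ρ_ A).inv]
    simpa using h1.symm
  obtain ⟨r, hr⟩ := exists_retraction hη
  intro h0
  have h1 := qdim_smul_id A
  rw [h0, zero_smul] at h1
  -- The trace is `η_ A Aᘁ ≫ s.hom ≫ ε_ A Aᘁ` with `s` invertible. Carried back along `s`, the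
  -- retraction `r` of the coevaluation is a multiple of the evaluation; a zero trace would thus
  -- make `𝟙 (𝟙_ C)` vanish.
  let s := (RibbonStructure.twist A ⊗ᵢ Iso.refl Aᘁ) ≪≫ β_ A Aᘁ
  have hs : η_ A Aᘁ ≫ s.hom ≫ ε_ A Aᘁ = 0 := by
    rw [h1]; simp [s, quantumTraceId]
  obtain ⟨z, hz⟩ := eq_smul_evaluation (s.inv ≫ r)
  have h2 : r = z • s.hom ≫ ε_ A Aᘁ := by
    rw [← Linear.comp_smul, ← hz, Iso.hom_inv_id_assoc]
  rw [h2, Linear.comp_smul, hs, smul_zero] at hr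
  exact id_unit_ne_zero hr.symm

variable {ι : Type*} [Fintype ι] {d : ℕ} {X : C} {S : ι → C}

theorem IsGYBEObject.qdim_mul_qdim (hX : IsGYBEObject d X S) (i : ι) :
    qdim X * qdim (S i) = ∑ j, qdim (S j) := by
  obtain ⟨e⟩ := hX.fusion i
  rw [← qdim_tensor, qdim_congr e, qdim_biproduct]

theorem IsGYBEObject.qdim_eq_of_ne_zero (hX : IsGYBEObject d X S) (hd : 0 < d)
    (h : qdim X ≠ 0) : qdim X = d := by
  have hne : Nonempty ι := Fintype.card_pos_iff.1 (hX.card_eq ▸ hd)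
  obtain ⟨i₀⟩ := hne
  have := hX.simple i₀
  have hsum : ∑ j, qdim (S j) ≠ 0 := by
    rw [← hX.qdim_mul_qdim i₀]
    exact mul_ne_zero h (qdim_ne_zero_of_simple _)
  -- The identities dim X · dim X_i = D are summed over the d indices i.
  apply mul_right_cancel₀ hsum
  rw [Finset.mul_sum, Finset.sum_congr rfl fun i _ => hX.qdim_mul_qdim i]
  simp [hX.card_eq]

theorem IsGYBEObject.qdim_ne_zero_of_pos (hX : IsGYBEObject d X S) (hd : 0 < d)
    (h : ∀ i, ∃ r : ℝ, 0 < r ∧ qdim (S i) = r) : qdim X ≠ 0 := by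
  have hne : Nonempty ι := Fintype.card_pos_iff.1 (hX.card_eq ▸ hd)
  obtain ⟨i₀⟩ := hne
  choose r hr hrS using h
  intro h0
  have h1 := hX.qdim_mul_qdim i₀
  rw [h0, zero_mul] at h1
  simp only [hrS] at h1
  have h2 : (0 : ℝ) < ∑ j, r j := Finset.sum_pos (fun j _ => hr j) ⟨i₀, Finset.mem_univ _⟩
  have h3 : ((∑ j, r j : ℝ) : ℂ) = 0 := by rw [Complex.ofReal_sum]; exact h1.symm
  exact h2.ne' (by exact_mod_cast h3)

end QuantumDimension

/-! ### Endomorphisms of two adjacent strands -/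

section Stacking

variable {C : Type u} [Category.{w} C] [MonoidalCategory C]

/-- The endomorphism `g` applied to the last two strands of `(A ⊗ X) ⊗ X`. -/
def topMap (A : C) {X : C} (g : X ⊗ X ⟶ X ⊗ X) : (A ⊗ X) ⊗ X ⟶ (A ⊗ X) ⊗ X :=
  (α_ A X X).hom ≫ A ◁ g ≫ (α_ A X X).inv

/-- The endomorphism `g` applied to the strands `p` and `p + 1` of `A ⊗ X^{⊗ n}`. -/
def stackMap (A : C) {X : C} (g : X ⊗ X ⟶ X ⊗ X) : ∀ (n _p : ℕ), leftPow A X n ⟶ leftPow A X n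
  | 0, _ => 𝟙 _
  | 1, _ => 𝟙 _
  | n + 2, p =>
    if p = n then topMap (leftPow A X n) g else stackMap A g (n + 1) p ▷ X

theorem stackMap_top (A : C) {X : C} (g : X ⊗ X ⟶ X ⊗ X) (n : ℕ) :
    stackMap A g (n + 2) n = topMap (leftPow A X n) g := if_pos rfl

theorem stackMap_of_ne (A : C) {X : C} (g : X ⊗ X ⟶ X ⊗ X) {n p : ℕ} (h : p ≠ n) :
    stackMap A g (n + 2) p = stackMap A g (n + 1) p ▷ X := if_neg h

/-- The interchange law. It yields both far commutativity and the locality of the braid action on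
trees. -/
theorem topMap_naturality {A B X : C} (f : A ⟶ B) (g : X ⊗ X ⟶ X ⊗ X) :
    f ▷ X ▷ X ≫ topMap B g = topMap A g ≫ f ▷ X ▷ X := by
  have h := whisker_exchange f g
  calc
    _ = (α_ A X X).hom ≫ (f ▷ (X ⊗ X) ≫ B ◁ g) ≫ (α_ B X X).inv := by simp [topMap]
    _ = _ := by rw [← h]; simp [topMap]

theorem topMap_comp (A : C) {X : C} (g h : X ⊗ X ⟶ X ⊗ X) :
    topMap A g ≫ topMap A h = topMap A (g ≫ h) := by
  simp [topMap]

theorem stackMap_comp (A : C) {X : C} (g h : X ⊗ X ⟶ X ⊗ X) :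
    ∀ n p : ℕ, stackMap A g n p ≫ stackMap A h n p = stackMap A (g ≫ h) n p
  | 0, _ => Category.id_comp _
  | 1, _ => Category.id_comp _
  | n + 2, p => by
    by_cases hp : p = n
    · subst hp
      rw [stackMap_top, stackMap_top, stackMap_top]
      exact topMap_comp _ _ _
    · simp only [stackMap_of_ne A _ hp, ← stackMap_comp A g h (n + 1) p]
      exact (comp_whiskerRight _ _ _).symm

theorem stackMap_id (A X : C) : ∀ n p : ℕ, stackMap A (𝟙 (X ⊗ X)) n p = 𝟙 _
  | 0, _ => rfl
  | 1, _ => rfl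
  | n + 2, p => by
    by_cases hp : p = n
    · subst hp
      simp [stackMap_top, topMap, leftPow]
    · rw [stackMap_of_ne A _ hp, stackMap_id A X (n + 1) p]
      exact id_whiskerRight _ _

instance isIso_stackMap (A : C) {X : C} (g : X ⊗ X ⟶ X ⊗ X) [IsIso g] (n p : ℕ) :
    IsIso (stackMap A g n p) :=
  ⟨stackMap A (inv g) n p, by rw [stackMap_comp, IsIso.hom_inv_id, stackMap_id],
    by rw [stackMap_comp, IsIso.inv_hom_id, stackMap_id]⟩

theorem whiskerLeft_sub_smul_id [Preadditive C] [Linear ℂ C] [MonoidalPreadditive C]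
    [MonoidalLinear ℂ C] (A : C) {B : C} (g : B ⟶ B) (z : ℂ) :
    A ◁ (g - z • 𝟙 B) = A ◁ g - z • 𝟙 (A ⊗ B) := by
  have h : A ◁ (g - z • 𝟙 B) = A ◁ g - A ◁ (z • 𝟙 B) := (tensorLeft A).map_sub
  rw [h, MonoidalLinear.whiskerLeft_smul, whiskerLeft_id]

theorem sub_smul_id_whiskerRight [Preadditive C] [Linear ℂ C] [MonoidalPreadditive C]
    [MonoidalLinear ℂ C] (A : C) {B : C} (g : B ⟶ B) (z : ℂ) :
    (g - z • 𝟙 B) ▷ A = g ▷ A - z • 𝟙 (B ⊗ A) := by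
  have h : (g - z • 𝟙 B) ▷ A = g ▷ A - (z • 𝟙 B) ▷ A := (tensorRight A).map_sub
  rw [h, MonoidalLinear.smul_whiskerRight, id_whiskerRight]

/-- The bound on `p` matters: for other `p` the recursion ends at an identity, whatever `g` is. -/
theorem stackMap_sub_smul_id [Preadditive C] [Linear ℂ C] [MonoidalPreadditive C]
    [MonoidalLinear ℂ C] (A : C) {X : C} (g : X ⊗ X ⟶ X ⊗ X) (z : ℂ) :
    ∀ n p : ℕ, p + 1 < n → stackMap A (g - z • 𝟙 _) n p = stackMap A g n p - z • 𝟙 _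
  | 0, p, h => by omega
  | 1, p, h => by omega
  | n + 2, p, h => by
    by_cases hp : p = n
    · subst hp
      rw [stackMap_top, stackMap_top]
      change _ = _ - z • 𝟙 ((leftPow A X p ⊗ X) ⊗ X)
      simp [topMap, whiskerLeft_sub_smul_id, Preadditive.comp_sub, Preadditive.sub_comp]
    · rw [stackMap_of_ne A _ hp, stackMap_of_ne A _ hp,
        stackMap_sub_smul_id A g z (n + 1) p (by omega)]
      exact sub_smul_id_whiskerRight _ _ _

variable [BraidedCategory C]

theorem stackBraid_eq_stackMap (A X : C) :
    ∀ n p : ℕ, stackBraid A X n p = stackMap A (β_ X X).hom n p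
  | 0, _ => rfl
  | 1, _ => rfl
  | n + 2, p => by
    simp only [stackBraid, stackMap, stackBraid_eq_stackMap A X (n + 1) p]
    rfl

theorem braidTop_braid_relation (A X : C) :
    braidTop A X ▷ X ≫ braidTop (A ⊗ X) X ≫ braidTop A X ▷ X =
      braidTop (A ⊗ X) X ≫ braidTop A X ▷ X ≫ braidTop (A ⊗ X) X := by
  have h := BraidedCategory.yang_baxter X X X
  unfold braidTop
  calc
    _ = 𝟙 _ ⊗≫ A ◁ ((α_ X X X).inv ≫ (β_ X X).hom ▷ X ≫ (α_ X X X).hom ≫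
          X ◁ (β_ X X).hom ≫ (α_ X X X).inv ≫ (β_ X X).hom ▷ X ≫ (α_ X X X).hom) ⊗≫ 𝟙 _ := by
      monoidal
    _ = _ := by
      rw [h]; monoidal

theorem stackBraid_of_ne (A X : C) {n p : ℕ} (h : p ≠ n) :
    stackBraid A X (n + 2) p = stackBraid A X (n + 1) p ▷ X := if_neg h

theorem stackBraid_top (A X : C) (n : ℕ) :
    stackBraid A X (n + 2) n = braidTop (leftPow A X n) X := if_pos rfl

theorem stackBraid_braid_relation (A X : C) : ∀ n p : ℕ, p + 2 < n →
    stackBraid A X n p ≫ stackBraid A X n (p + 1) ≫ stackBraid A X n p =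
      stackBraid A X n (p + 1) ≫ stackBraid A X n p ≫ stackBraid A X n (p + 1)
  | 0, p, h => by omega
  | 1, p, h => by omega
  | 2, p, h => by omega
  | n + 3, p, h => by
    by_cases hp : p = n
    · subst hp
      rw [stackBraid_top, stackBraid_of_ne A X (by omega : p ≠ p + 1), stackBraid_top]
      exact braidTop_braid_relation (leftPow A X p) X
    · rw [stackBraid_of_ne A X (by omega : p ≠ n + 1),
        stackBraid_of_ne A X (by omega : p + 1 ≠ n + 1)]
      have := congrArg (· ▷ X) (stackBraid_braid_relation A X (n + 2) p (by omega))
      simp only [comp_whiskerRight] at this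
      exact this

theorem stackBraid_far_commutativity (A X : C) : ∀ n p q : ℕ, p + 1 < q → q + 1 < n →
    stackBraid A X n p ≫ stackBraid A X n q = stackBraid A X n q ≫ stackBraid A X n p
  | 0, p, q, h, h' => by omega
  | 1, p, q, h, h' => by omega
  | 2, p, q, h, h' => by omega
  | n + 3, p, q, h, h' => by
    by_cases hq : q = n + 1
    · subst hq
      rw [stackBraid_top, stackBraid_of_ne A X (by omega : p ≠ n + 1),
        stackBraid_of_ne A X (by omega : p ≠ n)]
      exact topMap_naturality _ _
    · rw [stackBraid_of_ne A X (by omega : p ≠ n + 1), stackBraid_of_ne A X hq]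
      have := congrArg (· ▷ X) (stackBraid_far_commutativity A X (n + 2) p q h (by omega))
      simp only [comp_whiskerRight] at this
      exact this

instance isIso_stackBraid (A X : C) (n p : ℕ) : IsIso (stackBraid A X n p) := by
  rw [stackBraid_eq_stackMap]; infer_instance

end Stacking

/-! ### Trees, cotrees and their pairings -/

section WordTrees

variable {C : Type u} [Category.{w} C] [Preadditive C] [MonoidalCategory C]
  {ι : Type*} [DecidableEq ι]

/-- The identity morphism as a matrix unit: `𝟙` if the labels agree and zero otherwise. -/
def labelId (S : ι → C) (i j : ι) : S i ⟶ S j :=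
  if h : i = j then eqToHom (congrArg S h) else 0

@[simp]
theorem labelId_self (S : ι → C) (i : ι) : labelId S i i = 𝟙 (S i) := by simp [labelId]

theorem labelId_of_ne (S : ι → C) {i j : ι} (h : i ≠ j) : labelId S i j = 0 := by
  simp [labelId, h]

variable {S : ι → C} {X : C}

/-- The word tree as an element of the family of all morphism spaces. -/
def treeFamily (v : ∀ i j, S j ⟶ S i ⊗ X) (n : ℕ) (s : Fin (n + 1) → ι) :
    ∀ i j, S j ⟶ leftPow (S i) X n :=
  Pi.single (s 0) (Pi.single (s (Fin.last n)) (wordTree v n s))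

theorem treeFamily_self (v : ∀ i j, S j ⟶ S i ⊗ X) (n : ℕ) (s : Fin (n + 1) → ι) :
    treeFamily v n s (s 0) (s (Fin.last n)) = wordTree v n s := by
  simp [treeFamily]

theorem treeFamily_of_ne_first (v : ∀ i j, S j ⟶ S i ⊗ X) {n : ℕ} {s : Fin (n + 1) → ι} {i : ι}
    (h : i ≠ s 0) (j : ι) : treeFamily v n s i j = 0 := by
  simp [treeFamily, Pi.single_eq_of_ne h]

theorem treeFamily_of_ne_last (v : ∀ i j, S j ⟶ S i ⊗ X) {n : ℕ} {s : Fin (n + 1) → ι} (i : ι)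
    {j : ι} (h : j ≠ s (Fin.last n)) : treeFamily v n s i j = 0 := by
  by_cases hi : i = s 0
  · subst hi
    simp [treeFamily, Pi.single_eq_of_ne h]
  · exact treeFamily_of_ne_first v hi j

theorem treeFamily_zero (v : ∀ i j, S j ⟶ S i ⊗ X) (s : Fin 1 → ι) (i j : ι) :
    treeFamily v 0 s i j = if s 0 = i then labelId S j i else 0 := by
  split_ifs with h
  · subst h
    by_cases hj : j = s 0
    · subst hj
      rw [labelId_self]
      exact treeFamily_self v 0 s
    · rw [labelId_of_ne S hj]
      exact treeFamily_of_ne_last v _ hj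
  · exact treeFamily_of_ne_first v (Ne.symm h) j

variable [MonoidalPreadditive C]

theorem treeFamily_succ (v : ∀ i j, S j ⟶ S i ⊗ X) (n : ℕ) (s : Fin (n + 2) → ι) (i : ι) :
    treeFamily v (n + 1) s i (s (Fin.last (n + 1))) =
      v (s (Fin.last n).castSucc) (s (Fin.last (n + 1))) ≫
        treeFamily v n (fun q => s q.castSucc) i (s (Fin.last n).castSucc) ▷ X := by
  by_cases hi : i = s 0
  · subst hi
    rw [treeFamily_self]
    have := treeFamily_self v n (fun q => s q.castSucc)
    simp only [Fin.castSucc_zero] at this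
    rw [this]
    rfl
  · rw [treeFamily_of_ne_first v hi, treeFamily_of_ne_first v (by simpa using hi)]
    rw [MonoidalPreadditive.zero_whiskerRight, comp_zero]
    rfl

/-- The morphism dual to a word tree, built from dual vertices `w`. -/
def cotree (w : ∀ i j, S i ⊗ X ⟶ S j) :
    ∀ (n : ℕ) (_s : Fin (n + 1) → ι) (i j : ι), leftPow (S i) X n ⟶ S j
  | 0, s, i, j => if s 0 = i then labelId S i j else 0
  | n + 1, s, i, j => if s (Fin.last (n + 1)) = j then
      cotree w n (fun q => s q.castSucc) i (s (Fin.last n).castSucc) ▷ X ≫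
        w (s (Fin.last n).castSucc) j else 0

theorem cotree_succ (w : ∀ i j, S i ⊗ X ⟶ S j) (n : ℕ) (s : Fin (n + 2) → ι) (i : ι) :
    cotree w (n + 1) s i (s (Fin.last (n + 1))) =
      cotree w n (fun q => s q.castSucc) i (s (Fin.last n).castSucc) ▷ X ≫
        w (s (Fin.last n).castSucc) (s (Fin.last (n + 1))) := if_pos rfl

theorem cotree_of_ne_last (w : ∀ i j, S i ⊗ X ⟶ S j) :
    ∀ {n : ℕ} {s : Fin (n + 1) → ι} {i j : ι} (_ : j ≠ s (Fin.last n)), cotree w n s i j = 0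
  | 0, s, i, j, h => by
    by_cases h1 : s 0 = i
    · exact (if_pos h1).trans (labelId_of_ne S (fun h2 => h (by rw [← h2, ← h1]; rfl)))
    · exact if_neg h1
  | n + 1, s, i, j, h => if_neg h.symm

theorem treeFamily_comp_cotree {v : ∀ i j, S j ⟶ S i ⊗ X} {w : ∀ i j, S i ⊗ X ⟶ S j}
    (hvw : ∀ i j j', v i j ≫ w i j' = labelId S j j') :
    ∀ (n : ℕ) (s t : Fin (n + 1) → ι) (i j j' : ι), treeFamily v n s i j ≫ cotree w n t i j' =
      if s = t ∧ s 0 = i ∧ s (Fin.last n) = j then labelId S j j' else 0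
  | 0, s, t, i, j, j' => by
    have h : treeFamily v 0 s i j ≫ cotree w 0 t i j' =
        (if s 0 = i then labelId S j i else 0) ≫ (if t 0 = i then labelId S i j' else 0) := by
      rw [treeFamily_zero]; rfl
    refine h.trans ?_
    by_cases hs : s 0 = i
    · by_cases hj : s 0 = j
      · by_cases ht : t 0 = s 0
        · have hst : s = t := by
            ext q; rw [Subsingleton.elim (α := Fin 1) q 0]; exact ht.symm
          rw [if_pos hs, if_pos (ht.trans hs), if_pos ⟨hst, hs, hj⟩, ← hs, ← hj, labelId_self,
            Category.id_comp]
        · rw [if_neg (fun h' : t 0 = i => ht (h'.trans hs.symm)), comp_zero,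
            if_neg (fun h' : s = t ∧ _ => ht (h'.1 ▸ rfl))]
      · rw [if_pos hs, labelId_of_ne S (fun h' => hj (hs.trans h'.symm)), zero_comp,
          if_neg (fun h' => hj h'.2.2)]
    · rw [if_neg hs, zero_comp, if_neg (fun h' => hs h'.2.1)]
  | n + 1, s, t, i, j, j' => by
    by_cases hj : j = s (Fin.last (n + 1))
    swap
    · rw [treeFamily_of_ne_last v i hj, zero_comp, if_neg (fun h => hj h.2.2.symm)]
    by_cases hj' : j' = t (Fin.last (n + 1))
    swap
    · rw [cotree_of_ne_last w hj', comp_zero]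
      by_cases h : s = t ∧ s 0 = i ∧ s (Fin.last (n + 1)) = j
      · rw [if_pos h, labelId_of_ne S (fun h2 => hj' (by rw [← h2, hj, h.1]))]
      · rw [if_neg h]
    have hst : s = t ↔ (fun q : Fin (n + 1) => s q.castSucc) = (fun q => t q.castSucc) ∧
        s (Fin.last _) = t (Fin.last _) := by
      constructor
      · rintro rfl; simp
      · rintro ⟨h1, h2⟩
        ext q
        refine Fin.lastCases h2 (fun q => congrFun h1 q) q
    have ih := treeFamily_comp_cotree hvw n (fun q => s q.castSucc) (fun q => t q.castSucc) i
      (s (Fin.last n).castSucc) (t (Fin.last n).castSucc)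
    subst hj hj'
    rw [treeFamily_succ, cotree_succ]
    have e : (v (s (Fin.last n).castSucc) (s (Fin.last (n + 1))) ≫
        treeFamily v n (fun q => s q.castSucc) i (s (Fin.last n).castSucc) ▷ X) ≫
        cotree w n (fun q => t q.castSucc) i (t (Fin.last n).castSucc) ▷ X ≫
        w (t (Fin.last n).castSucc) (t (Fin.last (n + 1))) =
        v (s (Fin.last n).castSucc) (s (Fin.last (n + 1))) ≫
        (treeFamily v n (fun q => s q.castSucc) i (s (Fin.last n).castSucc) ≫
        cotree w n (fun q => t q.castSucc) i (t (Fin.last n).castSucc)) ▷ X ≫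
        w (t (Fin.last n).castSucc) (t (Fin.last (n + 1))) := by
      rw [comp_whiskerRight]
      simp only [Category.assoc]
    -- The shorter tree and cotree now meet in the middle and collapse to a `labelId`; only one
    -- vertex `v` against one dual vertex `w` remains.
    refine e.trans ?_
    rw [ih]
    by_cases h1 : (fun q : Fin (n + 1) => s q.castSucc) = (fun q => t q.castSucc)
    · have h2 : t (Fin.last n).castSucc = s (Fin.last n).castSucc :=
        (congrFun h1 (Fin.last n)).symm
      by_cases hi : s 0 = i
      · have hi' : s (Fin.castSucc 0) = i := hi
        rw [if_pos ⟨h1, hi', rfl⟩, h2, labelId_self, id_whiskerRight, Category.id_comp, hvw]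
        by_cases hjj : s (Fin.last (n + 1)) = t (Fin.last (n + 1))
        · rw [if_pos ⟨hst.2 ⟨h1, hjj⟩, hi, rfl⟩]
        · rw [labelId_of_ne S hjj, ite_self]
      · have hi' : ¬ s (Fin.castSucc 0) = i := hi
        rw [if_neg (fun h => hi' h.2.1), if_neg (fun h => hi h.2.1)]
        simp
    · rw [if_neg (fun h => h1 h.1), if_neg (fun h => h1 (hst.1 h.1).1)]
      simp

theorem sum_cotree_comp_treeFamily [Fintype ι] {v : ∀ i j, S j ⟶ S i ⊗ X}
    {w : ∀ i j, S i ⊗ X ⟶ S j} (hwv : ∀ i, ∑ j, w i j ≫ v i j = 𝟙 (S i ⊗ X)) (i : ι) :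
    ∀ n : ℕ, ∑ s : Fin (n + 1) → ι, cotree w n s i (s (Fin.last n)) ≫
      treeFamily v n s i (s (Fin.last n)) = 𝟙 (leftPow (S i) X n)
  | 0 => by
    rw [Finset.sum_eq_single (fun _ => i)]
    · have h : cotree w 0 (fun _ => i) i i ≫ treeFamily v 0 (fun _ => i) i i =
          labelId S i i ≫ labelId S i i := by
        rw [treeFamily_zero, if_pos rfl]
        exact congrArg (· ≫ _) (if_pos rfl)
      refine h.trans ?_
      rw [labelId_self, Category.id_comp]
      rfl
    · intro s _ hs
      have : i ≠ s 0 := fun h => hs (by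
        ext q; rw [Subsingleton.elim (α := Fin 1) q 0]; exact h.symm)
      rw [treeFamily_of_ne_first v this, comp_zero]
    · simp
  | n + 1 => by
    let F (t : Fin (n + 1) → ι) (a b : ι) : leftPow (S i) X n ⊗ X ⟶ leftPow (S i) X n ⊗ X :=
      cotree w n t i a ▷ X ≫ (w a b ≫ v a b) ≫ treeFamily v n t i a ▷ X
    have hassoc : ∀ {A B D E G : C} (a : A ⟶ B) (b : B ⟶ D) (c : D ⟶ E) (d : E ⟶ G),
        (a ≫ b) ≫ c ≫ d = a ≫ (b ≫ c) ≫ d := by intros; simp only [Category.assoc]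
    have hF : ∀ s : Fin (n + 2) → ι, cotree w (n + 1) s i (s (Fin.last (n + 1))) ≫
        treeFamily v (n + 1) s i (s (Fin.last (n + 1))) =
          F (fun q => s q.castSucc) (s (Fin.last n).castSucc) (s (Fin.last (n + 1))) := by
      intro s
      rw [cotree_succ, treeFamily_succ]
      exact hassoc _ _ _ _
    refine (Finset.sum_congr rfl fun s _ => hF s).trans ?_
    change ∑ s : Fin (n + 2) → ι,
      F (fun q => s q.castSucc) (s (Fin.last n).castSucc) (s (Fin.last (n + 1))) =
        𝟙 (leftPow (S i) X n ⊗ X)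
    -- Each word is split into an initial word and a last letter. The sum over the last letter is
    -- removed by `hwv`, leaving the previous resolution of the identity tensored with `X`.
    rw [← (Fin.snocEquiv (fun _ => ι)).sum_comp,
      Fintype.sum_prod_type_right]
    have ih := congrArg (· ▷ X) (sum_cotree_comp_treeFamily hwv i n)
    simp only [sum_whiskerRight] at ih
    refine (Finset.sum_congr rfl fun s _ => ?_).trans (ih.trans (id_whiskerRight _ _))
    rw [comp_whiskerRight, ← Category.id_comp (treeFamily v n s i _ ▷ X), ← hwv,
      Preadditive.sum_comp, Preadditive.comp_sum]
    refine Finset.sum_congr rfl fun j _ => ?_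
    simp only [Fin.snocEquiv_apply, Fin.snoc_castSucc, Fin.snoc_last, F]

end WordTrees

/-! ### The basis of words -/

section WordBasis

variable {ι : Type*} [Finite ι] [DecidableEq ι]

/-- The basis of elementary tensors of `V^{⊗ N}`, indexed by words. -/
def wordBasis (ι : Type*) [Finite ι] [DecidableEq ι] (N : ℕ) :
    Module.Basis (Fin N → ι) ℂ (⨂[ℂ]^N (ι → ℂ)) :=
  Basis.piTensorProduct fun _ => Pi.basisFun ℂ ι

theorem wordBasis_apply {N : ℕ} (s : Fin N → ι) : wordBasis ι N s = wordVec s := by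
  simp [wordBasis, wordVec]

end WordBasis

/-! ### Bases of left and right trees -/

section TreeBases

variable {C : Type u} [Category.{w} C] [Abelian C] [Linear ℂ C] [MonoidalCategory C]
  [MonoidalPreadditive C] [MonoidalLinear ℂ C] [RigidCategory C] [FusionCategory C]
  {ι : Type*} [Fintype ι] {S : ι → C} {X : C}

attribute [local instance] finiteDimensional_hom

theorem IsGYBEObject.exists_decomposition [BraidedCategory C] {d : ℕ} (hX : IsGYBEObject d X S)
    (i : ι) : ∃ (p : ∀ j, S j ⟶ S i ⊗ X) (q : ∀ j, S i ⊗ X ⟶ S j),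
      ∑ j, q j ≫ p j = 𝟙 _ ∧ ∀ j, p j ≫ q j = 𝟙 _ := by
  obtain ⟨e₀⟩ := hX.fusion i
  -- The fusion rule has `X` on the left and the trees have it on the right; the braiding changes
  -- sides.
  let e : S i ⊗ X ≅ ⨁ S := β_ (S i) X ≪≫ e₀
  refine ⟨fun j => biproduct.ι S j ≫ e.inv, fun j => e.hom ≫ biproduct.π S j, ?_, fun j => ?_⟩
  · have h : ∑ t, biproduct.π S t ≫ biproduct.ι S t = 𝟙 (⨁ S) :=
      IsBilimit.total (biproduct.isBilimit _)
    have h' := congrArg (fun x => e.hom ≫ x ≫ e.inv) h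
    simpa only [Preadditive.comp_sum, Preadditive.sum_comp, Category.assoc, Category.id_comp,
      Iso.hom_inv_id] using h'
  · simp

theorem IsGYBEObject.finrank_vertex [BraidedCategory C] {d : ℕ} (hX : IsGYBEObject d X S)
    (i j : ι) : Module.finrank ℂ (S j ⟶ S i ⊗ X) = 1 := by
  obtain ⟨p, q, hpq, hp⟩ := hX.exists_decomposition i
  have := hX.simple
  have h0 : p j ≠ 0 := by
    intro h
    have := hp j
    rw [h, zero_comp] at this
    exact id_nonzero _ this.symm
  rw [finrank_eq_one_iff_of_nonzero' _ h0]
  intro f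
  obtain ⟨z, hz⟩ := endomorphism_simple_eq_smul_id ℂ (f ≫ q j)
  refine ⟨z, ?_⟩
  rw [← Category.comp_id f, ← hpq, Preadditive.comp_sum, Finset.sum_eq_single j]
  · rw [← Category.assoc, ← hz]
    simp
  · intro k _ hk
    rw [← Category.assoc, hom_eq_zero_of_not_iso (fun h => hk (hX.distinct _ _ h).symm) (f ≫ q k),
      zero_comp]
  · simp

variable [DecidableEq ι]

theorem IsGYBEObject.exists_dual_vertices [BraidedCategory C] {d : ℕ} (hX : IsGYBEObject d X S)
    {v : ∀ i j, S j ⟶ S i ⊗ X} (hv : ∀ i j, v i j ≠ 0) :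
    ∃ w : ∀ i j, S i ⊗ X ⟶ S j, (∀ i j j', v i j ≫ w i j' = labelId S j j') ∧
      ∀ i, ∑ j, w i j ≫ v i j = 𝟙 (S i ⊗ X) := by
  have key : ∀ i, ∃ w : ∀ j, S i ⊗ X ⟶ S j, (∀ j j', v i j ≫ w j' = labelId S j j') ∧
      ∑ j, w j ≫ v i j = 𝟙 (S i ⊗ X) := by
    intro i
    obtain ⟨p, q, hpq, hp⟩ := hX.exists_decomposition i
    obtain ⟨b', h1, h2⟩ := exists_dual_basis hX.simple hX.distinct p q hpq
      (fun j => ⟨j, ⟨Iso.refl _⟩⟩)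
      (fun j => FiniteDimensional.basisSingleton Unit (hX.finrank_vertex i j) (v i j) (hv i j))
    simp only [FiniteDimensional.basisSingleton_apply, Finset.univ_unique, Finset.sum_singleton] at h1 h2
    refine ⟨fun j => b' j (), fun j j' => ?_, h2⟩
    have := hX.simple
    by_cases h : j = j'
    · subst h
      rw [labelId_self]
      exact (h1 j () ()).trans (if_pos trivial)
    · rw [labelId_of_ne S h]
      exact hom_eq_zero_of_not_iso (fun h' => h (hX.distinct _ _ h')) _
  choose w hw1 hw2 using key
  exact ⟨w, hw1, hw2⟩

/-- Pairing with cotrees extracts coefficients, which gives independence; inserting the resolution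
of the identity and applying Schur's lemma gives spanning. -/
theorem exists_treeBasis (hS : ∀ i, Simple (S i))
    (hdist : ∀ i j, Nonempty (S i ≅ S j) → i = j) {v : ∀ i j, S j ⟶ S i ⊗ X}
    {w : ∀ i j, S i ⊗ X ⟶ S j} (hvw : ∀ i j j', v i j ≫ w i j' = labelId S j j')
    (hwv : ∀ i, ∑ j, w i j ≫ v i j = 𝟙 (S i ⊗ X)) (n : ℕ) :
    ∃ B : Module.Basis (Fin (n + 1) → ι) ℂ (∀ i j, S j ⟶ leftPow (S i) X n),
      ∀ s, B s = treeFamily v n s := by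
  have hli : LinearIndependent ℂ (treeFamily v n) := by
    rw [Fintype.linearIndependent_iff]
    intro z hz t
    have h := congrArg (· ≫ cotree w n t (t 0) (t (Fin.last n)))
      (congrFun (congrFun hz (t 0)) (t (Fin.last n)))
    simp only [Finset.sum_apply, Pi.smul_apply, Preadditive.sum_comp, Linear.smul_comp,
      treeFamily_comp_cotree hvw, Pi.zero_apply, zero_comp] at h
    rw [Finset.sum_eq_single t (fun s _ hs => by simp [hs]) (by simp)] at h
    rw [if_pos ⟨rfl, rfl, rfl⟩, labelId_self] at h
    exact (smul_eq_zero.1 h).resolve_right (id_nonzero _)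
  have hsp : ⊤ ≤ Submodule.span ℂ (Set.range (treeFamily v n)) := by
    intro x _
    have hc : ∀ s : Fin (n + 1) → ι, ∃ z : ℂ, z • 𝟙 (S (s (Fin.last n))) =
        x (s 0) (s (Fin.last n)) ≫ cotree w n s (s 0) (s (Fin.last n)) := fun s =>
      endomorphism_simple_eq_smul_id ℂ _
    choose z hz using hc
    have hx : x = ∑ s, z s • treeFamily v n s := by
      funext i j
      rw [← Category.comp_id (x i j), ← sum_cotree_comp_treeFamily hwv i n, Preadditive.comp_sum]
      simp only [Finset.sum_apply, Pi.smul_apply]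
      refine Finset.sum_congr rfl fun s _ => ?_
      by_cases hi : i = s 0
      swap
      · rw [treeFamily_of_ne_first v hi, treeFamily_of_ne_first v hi, comp_zero, comp_zero,
          smul_zero]
      by_cases hj : j = s (Fin.last n)
      · subst hi hj
        rw [← Category.assoc, ← hz, Linear.smul_comp, Category.id_comp]
      · rw [treeFamily_of_ne_last v i hj, smul_zero, ← Category.assoc,
          hom_eq_zero_of_not_iso (fun h => hj (hdist _ _ h))
            (x i j ≫ cotree w n s i (s (Fin.last n))), zero_comp]
    rw [hx]
    exact Submodule.sum_mem _ fun s _ => Submodule.smul_mem _ _ (Submodule.subset_span ⟨s, rfl⟩)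
  exact ⟨Module.Basis.mk hli hsp, fun s => by simp⟩

/-- The case of two strands with both end labels fixed, in the form that defines the blocks `M i j`;
unlike `wordTree`, `leftTree` carries no trailing identity. -/
theorem exists_leftTreeBasis {v : ∀ i j, S j ⟶ S i ⊗ X}
    (hv1 : ∀ i j, Module.finrank ℂ (S j ⟶ S i ⊗ X) = 1) (hv : ∀ i j, v i j ≠ 0)
    {w : ∀ i j, S i ⊗ X ⟶ S j} (hvw : ∀ i j j', v i j ≫ w i j' = labelId S j j')
    (hwv : ∀ i, ∑ j, w i j ≫ v i j = 𝟙 (S i ⊗ X)) (i j : ι) :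
    ∃ B : Module.Basis ι ℂ (S j ⟶ (S i ⊗ X) ⊗ X), ∀ k, B k = leftTree v i k j := by
  have hli : LinearIndependent ℂ (fun k => leftTree v i k j) := by
    rw [Fintype.linearIndependent_iff]
    intro z hz k
    have h := congrArg (· ≫ w i k ▷ X) hz
    simp only [leftTree, Preadditive.sum_comp, Linear.smul_comp, Category.assoc, zero_comp,
      ← comp_whiskerRight, hvw] at h
    rw [Finset.sum_eq_single k (fun l _ hl => by simp [labelId_of_ne S hl]) (by simp),
      labelId_self, id_whiskerRight, Category.comp_id] at h
    exact (smul_eq_zero.1 h).resolve_right (hv _ _)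
  have hsp : ⊤ ≤ Submodule.span ℂ (Set.range (fun k => leftTree v i k j)) := by
    intro f _
    have hc : ∀ k, ∃ z : ℂ, z • v k j = f ≫ w i k ▷ X := fun k =>
      (finrank_eq_one_iff_of_nonzero' _ (hv k j)).1 (hv1 k j) _
    choose z hz using hc
    have hf : f = ∑ k, z k • leftTree v i k j := by
      rw [← Category.comp_id f, ← id_whiskerRight, ← hwv, sum_whiskerRight, Preadditive.comp_sum]
      refine Finset.sum_congr rfl fun k _ => ?_
      rw [comp_whiskerRight, ← Category.assoc, ← hz, Linear.smul_comp, leftTree]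
    rw [hf]
    exact Submodule.sum_mem _ fun s _ => Submodule.smul_mem _ _ (Submodule.subset_span ⟨s, rfl⟩)
  exact ⟨Module.Basis.mk hli hsp, fun s => by simp⟩

/-- The basis dual to `b` isolates the channel `Y k` and the vector of Hom(Y k, X ⊗ X); what is left
is expanded in `f k`. -/
theorem exists_rightTreeBasis {κ : Type*} [Fintype κ] [DecidableEq κ] {Y : κ → C}
    (hY : IsSimpleRepresentatives Y) (A D X : C) {a c : κ → ℕ}
    (b : ∀ k, Module.Basis (Fin (a k)) ℂ (Y k ⟶ X ⊗ X))
    (f : ∀ k, Module.Basis (Fin (c k)) ℂ (D ⟶ A ⊗ Y k)) :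
    ∃ B : Module.Basis (Σ k, Fin (a k) × Fin (c k)) ℂ (D ⟶ (A ⊗ X) ⊗ X),
      ∀ q, B q = rightTree (f q.1 q.2.2) (b q.1 q.2.1) := by
  obtain ⟨n, g, p, q, hg, hpq⟩ := exists_simple_decomposition (X ⊗ X)
  have hdist : ∀ k l, Nonempty (Y k ≅ Y l) → k = l := by
    intro k l h
    exact (hY.exists_unique (Y k) (hY.simple k)).unique ⟨Iso.refl _⟩ h
  obtain ⟨b', hb1, hb2⟩ := exists_dual_basis hY.simple hdist p q hpq
    (fun t => (hY.exists_unique (g t) (hg t)).exists.imp fun k ⟨e⟩ => ⟨e.symm⟩) b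
  have := hY.simple
  have hb0 : ∀ {k l} (_ : k ≠ l) r s, b k r ≫ b' l s = 0 := fun h r s =>
    hom_eq_zero_of_not_iso (fun h' => h (hdist _ _ h')) _
  have hli : LinearIndependent ℂ (fun q : Σ k, Fin (a k) × Fin (c k) =>
      rightTree (f q.1 q.2.2) (b q.1 q.2.1)) := by
    rw [Fintype.linearIndependent_iff]
    rintro z hz ⟨k, r, t⟩
    have h := congrArg (· ≫ (α_ A X X).hom ≫ A ◁ b' k r) hz
    simp only [rightTree, Preadditive.sum_comp, Linear.smul_comp, Category.assoc, zero_comp,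
      Iso.inv_hom_id_assoc, ← whiskerLeft_comp] at h
    rw [Fintype.sum_sigma, Finset.sum_eq_single k
      (fun l _ hl => by simp [hb0 hl]) (by simp), Fintype.sum_prod_type,
      Finset.sum_eq_single r (fun l _ hl => by simp [hb1, hl]) (by simp)] at h
    simp only [hb1, if_true, whiskerLeft_id, Category.comp_id] at h
    exact Fintype.linearIndependent_iff.1 (f k).linearIndependent _ h t
  have hsp : ⊤ ≤ Submodule.span ℂ (Set.range (fun q : Σ k, Fin (a k) × Fin (c k) =>
      rightTree (f q.1 q.2.2) (b q.1 q.2.1))) := by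
    intro x _
    have hx : x = ∑ k, ∑ r, ∑ t, (f k).repr (x ≫ (α_ A X X).hom ≫ A ◁ b' k r) t •
        rightTree (f k t) (b k r) := by
      have h1 : x = (x ≫ (α_ A X X).hom) ≫ A ◁ (𝟙 (X ⊗ X)) ≫ (α_ A X X).inv := by simp
      refine h1.trans ?_
      rw [← hb2]
      simp only [whiskerLeft_sum, Preadditive.comp_sum, Preadditive.sum_comp]
      refine Finset.sum_congr rfl fun k _ => Finset.sum_congr rfl fun r _ => ?_
      simp only [rightTree, ← Linear.smul_comp, ← Preadditive.sum_comp]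
      rw [(f k).sum_repr]
      simp
    rw [hx]
    exact Submodule.sum_mem _ fun k _ => Submodule.sum_mem _ fun r _ => Submodule.sum_mem _
      fun t _ => Submodule.smul_mem _ _ (Submodule.subset_span ⟨⟨k, r, t⟩, rfl⟩)
  exact ⟨Module.Basis.mk hli hsp, fun s => by simp⟩

end TreeBases

/-! ### Local operators on words -/

section SiteOperators

variable {ι : Type*} [Finite ι] [DecidableEq ι]

theorem siteOp_wordVec_append {m : ℕ} (R : Module.End ℂ (⨂[ℂ]^m (ι → ℂ))) {a c N : ℕ}
    (h : a + m + c = N) {σ : Type*} (t : Finset σ) (x : Fin a → ι) (y : Fin m → ι)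
    (z : Fin c → ι) (r : σ → ℂ) (y' : σ → Fin m → ι)
    (hR : R (wordVec y) = ∑ k ∈ t, r k • wordVec (y' k)) :
    siteOp R a c h (wordVec (Fin.append (Fin.append x y) z ∘ Fin.cast h.symm)) =
      ∑ k ∈ t, r k • wordVec (Fin.append (Fin.append x (y' k)) z ∘ Fin.cast h.symm) := by
  let e : ((⨂[ℂ]^a (ι → ℂ)) ⊗[ℂ] (⨂[ℂ]^m (ι → ℂ))) ⊗[ℂ] (⨂[ℂ]^c (ι → ℂ)) ≃ₗ[ℂ] ⨂[ℂ]^N (ι → ℂ) :=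
    (TensorProduct.congr TensorPower.mulEquiv (LinearEquiv.refl ℂ (⨂[ℂ]^c (ι → ℂ)))).trans
      (TensorPower.mulEquiv.trans (TensorPower.cast ℂ (ι → ℂ) h))
  have he : ∀ y : Fin m → ι, e ((wordVec x ⊗ₜ wordVec y) ⊗ₜ wordVec z) =
      wordVec (Fin.append (Fin.append x y) z ∘ Fin.cast h.symm) := by
    intro y
    simp only [e, LinearEquiv.trans_apply, TensorProduct.congr_tmul, LinearEquiv.refl_apply,
      wordVec]
    have happ : ∀ {p q : ℕ} (f : Fin p → ι) (g : Fin q → ι),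
        Fin.append (fun i => (Pi.single (f i) 1 : ι → ℂ)) (fun i => Pi.single (g i) 1) =
          fun i => Pi.single (Fin.append f g i) 1 := by
      intro p q f g
      funext i
      refine Fin.addCases (fun i => ?_) (fun i => ?_) i <;> simp
    have h1 := TensorPower.tprod_mul_tprod ℂ (fun q => (Pi.single (x q) 1 : ι → ℂ))
      (fun q => Pi.single (y q) 1)
    rw [TensorPower.gMul_def, happ] at h1
    rw [h1]
    have h2 := TensorPower.tprod_mul_tprod ℂ (fun q => (Pi.single (Fin.append x y q) 1 : ι → ℂ))
      (fun q => Pi.single (z q) 1)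
    rw [TensorPower.gMul_def, happ] at h2
    rw [h2, TensorPower.cast_tprod]
    rfl
  have hsite : siteOp R a c h =
      e.conj (TensorProduct.map (TensorProduct.map LinearMap.id R) LinearMap.id) := rfl
  rw [hsite, ← he, LinearEquiv.conj_apply_apply, LinearEquiv.symm_apply_apply]
  simp only [TensorProduct.map_tmul, LinearMap.id_apply, hR, TensorProduct.tmul_sum,
    TensorProduct.sum_tmul, map_sum, TensorProduct.tmul_smul, ← TensorProduct.smul_tmul', map_smul,
    he]

theorem siteOp_wordVec [Fintype ι] {R : Module.End ℂ (⨂[ℂ]^3 (ι → ℂ))}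
    {M : ι → ι → Matrix ι ι ℂ}
    (hR : ∀ i k j, R (wordVec ![i, k, j]) = ∑ k', M i j k' k • wordVec ![i, k', j])
    {a c N : ℕ} (h : a + 3 + c = N) (s : Fin N → ι) :
    siteOp R a c h (wordVec s) = ∑ k', M (s ⟨a, by omega⟩) (s ⟨a + 2, by omega⟩) k'
      (s ⟨a + 1, by omega⟩) • wordVec (Function.update s ⟨a + 1, by omega⟩ k') := by
  subst h
  -- Around position `a + 1` the word is cut into a prefix, the three letters seen by `R`, and a
  -- suffix.
  have hs : ∀ k', Function.update s ⟨a + 1, by omega⟩ k' = Fin.append (Fin.append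
      (fun q : Fin a => s ⟨q, by omega⟩) ![s ⟨a, by omega⟩, k', s ⟨a + 2, by omega⟩])
      (fun q : Fin c => s ⟨a + 3 + q, by omega⟩) ∘ Fin.cast rfl := by
    intro k'
    funext i
    refine Fin.addCases (fun i => ?_) (fun i => ?_) i
    · refine Fin.addCases (fun i => ?_) (fun i => ?_) i
      · rw [Function.update_of_ne (by simp [Fin.ext_iff]; omega)]
        simp
        rfl
      · fin_cases i
        · rw [Function.update_of_ne (by simp [Fin.ext_iff])]
          simp
          rfl
        · refine (Function.update_self (f := s) ⟨a + 1, by omega⟩ k').trans ?_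
          simp only [Function.comp_apply, Fin.cast_refl, id_eq, Fin.append_left, Fin.append_right]
          rfl
        · rw [Function.update_of_ne (by simp [Fin.ext_iff])]
          simp
          rfl
    · rw [Function.update_of_ne (by simp [Fin.ext_iff]; omega)]
      simp
      rfl
  have h0 := hs (s ⟨a + 1, by omega⟩)
  rw [Function.update_eq_self] at h0
  simp only [hs]
  conv_lhs => rw [h0]
  exact siteOp_wordVec_append R rfl Finset.univ _ _ _ _ _ (hR _ _ _)

end SiteOperators

/-! ### Braids acting on trees -/

section TreeAction

variable {C : Type u} [Category.{w} C] [Preadditive C] [Linear ℂ C] [MonoidalCategory C]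
  [MonoidalPreadditive C] [MonoidalLinear ℂ C]
  {ι : Type*} [Fintype ι] [DecidableEq ι] {S : ι → C} {X : C}

theorem treeFamily_succ_of_eq (v : ∀ i j, S j ⟶ S i ⊗ X) {n : ℕ} {s : Fin (n + 2) → ι}
    {t : Fin (n + 1) → ι} {a j : ι} (i : ι) (ht : ∀ q, s (Fin.castSucc q) = t q)
    (ha : t (Fin.last n) = a) (hj : s (Fin.last (n + 1)) = j) :
    treeFamily v (n + 1) s i j = v a j ≫ treeFamily v n t i a ▷ X := by
  obtain rfl : (fun q => s q.castSucc) = t := funext ht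
  subst ha hj
  exact treeFamily_succ v n s i

/-- Locality: only the two vertices at which the braided strands are attached take part, so the
two-strand matrix `M` governs every `n`. -/
theorem treeFamily_comp_stackBraid [BraidedCategory C] {v : ∀ i j, S j ⟶ S i ⊗ X}
    {M : ι → ι → Matrix ι ι ℂ}
    (hM : ∀ i k j, leftTree v i k j ≫ braidTop (S i) X = ∑ k', M i j k' k • leftTree v i k' j) :
    ∀ (n p : ℕ) (h : p + 1 < n) (s : Fin (n + 1) → ι) (i j : ι),
      treeFamily v n s i j ≫ stackBraid (S i) X n p =
        ∑ k', M (s ⟨p, by omega⟩) (s ⟨p + 2, by omega⟩) k' (s ⟨p + 1, by omega⟩) •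
          treeFamily v n (Function.update s ⟨p + 1, by omega⟩ k') i j
  | 0, p, h, s, i, j => by omega
  | 1, p, h, s, i, j => by omega
  | n + 2, p, h, s, i, j => by
    have hlast : ∀ k', Function.update s ⟨p + 1, by omega⟩ k' (Fin.last (n + 2)) =
        s (Fin.last (n + 2)) := fun k' =>
      Function.update_of_ne (by simp [Fin.ext_iff]; omega) _ _
    by_cases hj : s (Fin.last (n + 2)) = j
    swap
    · rw [treeFamily_of_ne_last v i (Ne.symm hj), zero_comp]
      refine (Finset.sum_eq_zero fun k' _ => ?_).symm
      rw [treeFamily_of_ne_last v i (by rw [hlast]; exact Ne.symm hj), smul_zero]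
    by_cases hp : p = n
    · subst hp
      -- For the top two strands, the tree is a left tree starting from the label `a`, followed by
      -- the rest of the tree; naturality moves the braiding past that rest onto the left tree.
      let a := s ⟨p, by omega⟩
      let t : Fin (p + 1) → ι := fun q => s q.castSucc.castSucc
      have key : ∀ k', treeFamily v (p + 2) (Function.update s ⟨p + 1, by omega⟩ k') i j =
          leftTree v a k' j ≫ treeFamily v p t i a ▷ X ▷ X := by
        intro k'
        rw [treeFamily_succ_of_eq v
            (t := fun q => Function.update s ⟨p + 1, by omega⟩ k' q.castSucc) (a := k') i
            (fun q => rfl) (Function.update_self (f := s) ⟨p + 1, by omega⟩ k')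
            ((hlast k').trans hj),
          treeFamily_succ_of_eq v (t := t) (a := a) i
            (fun q => Function.update_of_ne (by simp [Fin.ext_iff]; omega) _ _) rfl
            (Function.update_self (f := s) ⟨p + 1, by omega⟩ k')]
        have haux : ∀ {A B D E : C} (f : A ⟶ B ⊗ X) (g : B ⟶ D ⊗ X) (h : D ⟶ E),
            f ≫ (g ≫ h ▷ X) ▷ X = (f ≫ g ▷ X) ≫ h ▷ X ▷ X := by intros; simp
        exact haux _ _ _
      have key' := key (s ⟨p + 1, by omega⟩)
      rw [Function.update_eq_self] at key'
      rw [stackBraid_top, key']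
      simp only [key]
      have hnat : treeFamily v p t i a ▷ X ▷ X ≫ braidTop (leftPow (S i) X p) X =
          braidTop (S a) X ≫ treeFamily v p t i a ▷ X ▷ X := topMap_naturality _ _
      have haux : (leftTree v a (s ⟨p + 1, by omega⟩) j ≫ treeFamily v p t i a ▷ X ▷ X) ≫
          braidTop (leftPow (S i) X p) X = ∑ k', M a j k' (s ⟨p + 1, by omega⟩) •
            (leftTree v a k' j ≫ treeFamily v p t i a ▷ X ▷ X) := by
        rw [Category.assoc, hnat, ← Category.assoc, hM, Preadditive.sum_comp]
        simp only [Linear.smul_comp]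
      subst hj
      exact haux
    -- For lower strands the last vertex is a bystander: it is peeled off, and letter `p + 1` is not
    -- the last letter of the shorter word.
    · have ih := treeFamily_comp_stackBraid hM (n + 1) p (by omega) (fun q => s q.castSucc) i
        (s (Fin.last (n + 1)).castSucc)
      rw [treeFamily_succ_of_eq v (t := fun q => s q.castSucc) i (fun q => rfl) rfl hj,
        stackBraid_of_ne _ _ hp]
      have haux : ∀ {A B D : C} (f : A ⟶ B ⊗ X) {g : B ⟶ D} {k : D ⟶ D} {r : ι → ℂ}
          {g' : ι → (B ⟶ D)} (_ : g ≫ k = ∑ k', r k' • g' k'),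
          (f ≫ g ▷ X) ≫ k ▷ X = ∑ k', r k' • (f ≫ g' k' ▷ X) := by
        intro A B D f g k r g' h
        rw [Category.assoc, ← comp_whiskerRight, h]
        simp only [sum_whiskerRight, Preadditive.comp_sum, MonoidalLinear.smul_whiskerRight,
          Linear.comp_smul]
      refine (haux _ ih).trans ?_
      refine Finset.sum_congr rfl fun k' _ => ?_
      congr 1
      by_cases hpn : p + 1 = n + 1
      · omega
      · refine (treeFamily_succ_of_eq v i (fun q => ?_) ?_ ((hlast k').trans hj)).symm
        · simp only [Function.update_apply, Fin.ext_iff, Fin.val_castSucc]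
        · exact Function.update_of_ne (by simp [Fin.ext_iff]; omega) _ _

end TreeAction

/-! ### The braid group representation -/

section Representation

variable {C : Type u} [Category.{w} C] [Preadditive C] [Linear ℂ C] [MonoidalCategory C]
  [BraidedCategory C] {ι : Type*} {S : ι → C} {X : C}
  {V : Type*} [AddCommGroup V] [Module ℂ V] {n : ℕ}

/-- Braiding the strands `p` and `p + 1`, as an automorphism of the family of all morphism
spaces. -/
def stackEquiv (S : ι → C) (X : C) (n p : ℕ) :
    (∀ i j, S j ⟶ leftPow (S i) X n) ≃ₗ[ℂ] (∀ i j, S j ⟶ leftPow (S i) X n) :=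
  LinearEquiv.piCongrRight fun i => LinearEquiv.piCongrRight fun j =>
    Linear.homCongr ℂ (Iso.refl (S j)) (asIso (stackBraid (S i) X n p))

theorem stackEquiv_apply (p : ℕ) (x : ∀ i j, S j ⟶ leftPow (S i) X n) (i j : ι) :
    stackEquiv S X n p x i j = x i j ≫ stackBraid (S i) X n p := by
  simp [stackEquiv, Linear.homCongr_apply]

theorem exists_braidGroup_representation (Φ : V ≃ₗ[ℂ] (∀ i j, S j ⟶ leftPow (S i) X n)) :
    ∃ ρ : Representation ℂ (BraidGroup n) V, ∀ (p : Fin (n - 1)) x i j,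
      Φ (ρ (braidGen p) x) i j = Φ x i j ≫ stackBraid (S i) X n p.val := by
  let f : Fin (n - 1) → (V ≃ₗ[ℂ] V) := fun p => (Φ.trans (stackEquiv S X n p)).trans Φ.symm
  have hf : ∀ p x i j, Φ (f p x) i j = Φ x i j ≫ stackBraid (S i) X n p.val := by
    intro p x i j
    simp [f, stackEquiv_apply]
  have hrel : ∀ r ∈ {r | BraidRel n r}, FreeGroup.lift f r = 1 := by
    rintro r (⟨p, q, h⟩ | ⟨p, q, h⟩)
    · simp only [map_mul, map_inv, FreeGroup.lift_apply_of]
      rw [mul_inv_eq_one]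
      ext x
      apply Φ.injective
      funext i j
      simp only [LinearEquiv.mul_apply, hf, Category.assoc]
      rw [← h, stackBraid_braid_relation _ _ _ _ (by omega)]
    · simp only [map_mul, map_inv, FreeGroup.lift_apply_of]
      rw [mul_inv_eq_one]
      ext x
      apply Φ.injective
      funext i j
      simp only [LinearEquiv.mul_apply, hf, Category.assoc]
      rw [stackBraid_far_commutativity _ _ _ _ _ h (by omega)]
  refine ⟨(LinearEquiv.automorphismGroup.toLinearMapMonoidHom).comp
    (PresentedGroup.toGroup hrel), fun p x i j => ?_⟩
  have : PresentedGroup.toGroup hrel (braidGen p) = f p := PresentedGroup.toGroup.of hrel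
  rw [MonoidHom.comp_apply, this]
  exact hf p x i j

/-- Elements acting by postcomposition form a subgroup that contains the generators. Hence no braid
can mix the components `i, j`. -/
theorem exists_iso_of_representation {Φ : V ≃ₗ[ℂ] (∀ i j, S j ⟶ leftPow (S i) X n)}
    {ρ : Representation ℂ (BraidGroup n) V} (hρ : ∀ (p : Fin (n - 1)) x i j,
      Φ (ρ (braidGen p) x) i j = Φ x i j ≫ stackBraid (S i) X n p.val) (g : BraidGroup n) :
    ∃ t : ∀ i, leftPow (S i) X n ≅ leftPow (S i) X n,
      ∀ x i j, Φ (ρ g x) i j = Φ x i j ≫ (t i).hom := by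
  let H : Subgroup (BraidGroup n) :=
    { carrier := {g | ∃ t : ∀ i, leftPow (S i) X n ≅ leftPow (S i) X n,
        ∀ x i j, Φ (ρ g x) i j = Φ x i j ≫ (t i).hom}
      one_mem' := ⟨fun i => Iso.refl _, by simp⟩
      mul_mem' := by
        rintro a b ⟨s, hs⟩ ⟨t, ht⟩
        exact ⟨fun i => t i ≪≫ s i, fun x i j => by simp [hs, ht]⟩
      inv_mem' := by
        rintro a ⟨s, hs⟩
        refine ⟨fun i => (s i).symm, fun x i j => ?_⟩
        have h := hs (ρ a⁻¹ x) i j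
        rw [← Module.End.mul_apply, ← map_mul, mul_inv_cancel, map_one,
          Module.End.one_apply] at h
        rw [h]
        simp }
  exact PresentedGroup.generated_by _ H
    (fun p => ⟨fun i => asIso (stackBraid (S i) X n p), fun x i j => hρ p x i j⟩) g

/-- If `z` occurs on no Hom(Y k, X ⊗ X), then c - z is monic, since this is tested on simples, hence
invertible. Then so is c - z on two strands, and it cannot kill an eigenvector. -/
theorem hasEigenvalue_comp_of_representation {C : Type u} [Category.{w} C] [Abelian C]
    [Linear ℂ C] [MonoidalCategory C] [MonoidalPreadditive C] [MonoidalLinear ℂ C]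
    [RigidCategory C] [FusionCategory C] [BraidedCategory C] {S : ι → C} {X : C}
    {κ : Type*} {Y : κ → C}
    (hY : IsSimpleRepresentatives Y) {Φ : V ≃ₗ[ℂ] (∀ i j, S j ⟶ leftPow (S i) X n)} {p : ℕ}
    (hp : p + 1 < n) {T : Module.End ℂ V}
    (hT : ∀ x i j, Φ (T x) i j = Φ x i j ≫ stackBraid (S i) X n p) {z : ℂ}
    (hz : T.HasEigenvalue z) : ∃ k, (braidingOp (Y k) X).HasEigenvalue z := by
  by_contra! hk
  obtain ⟨x, hx⟩ := hz.exists_hasEigenvector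
  have hmono : Mono ((β_ X X).hom - z • 𝟙 (X ⊗ X)) := by
    refine mono_of_forall_simple hY _ fun k f hf => ?_
    by_contra hf0
    refine hk k (Module.End.hasEigenvalue_of_hasEigenvector (x := f)
      (Module.End.hasEigenvector_iff.2 ⟨Module.End.mem_eigenspace_iff.2 ?_, hf0⟩))
    rw [Preadditive.comp_sub, sub_eq_zero] at hf
    refine hf.trans ?_
    simp
  have hiso := isIso_of_mono_endomorphism ((β_ X X).hom - z • 𝟙 (X ⊗ X))
  apply hx.2
  apply Φ.injective
  rw [map_zero]
  funext i j
  have h1 := hT x i j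
  rw [hx.apply_eq_smul, map_smul, Pi.smul_apply, Pi.smul_apply] at h1
  have h2 : Φ x i j ≫ stackMap (S i) ((β_ X X).hom - z • 𝟙 (X ⊗ X)) n p = 0 := by
    rw [stackMap_sub_smul_id _ _ _ _ _ hp, Preadditive.comp_sub, ← stackBraid_eq_stackMap, ← h1,
      Linear.comp_smul, Category.comp_id, sub_self]
  rw [← cancel_mono (stackMap (S i) ((β_ X X).hom - z • 𝟙 (X ⊗ X)) n p), h2, Pi.zero_apply,
    Pi.zero_apply, zero_comp]

theorem encard_hasEigenvalue_le {W : Type*} [AddCommGroup W] [Module ℂ W] [FiniteDimensional ℂ W]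
    (T : Module.End ℂ W) : {z : ℂ | T.HasEigenvalue z}.encard ≤ Module.finrank ℂ W := by
  have h : {z : ℂ | T.HasEigenvalue z} ⊆ (T.charpoly.roots.toFinset : Set ℂ) := by
    intro z hz
    rw [Finset.mem_coe, Multiset.mem_toFinset, Polynomial.mem_roots T.charpoly_monic.ne_zero]
    exact (Module.End.hasEigenvalue_iff_isRoot_charpoly T z).1 hz
  refine (Set.encard_le_encard h).trans ?_
  rw [Set.encard_coe_eq_coe_finsetCard]
  refine Nat.cast_le.2 ((Multiset.toFinset_card_le _).trans ?_)
  exact (Polynomial.card_roots' _).trans (LinearMap.charpoly_natDegree T).le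

theorem encard_iUnion_le_sum {κ α : Type*} [Fintype κ] (A : κ → Set α) :
    (⋃ k, A k).encard ≤ ∑ k, (A k).encard := by
  classical
  have : ∀ s : Finset κ, (⋃ k ∈ s, A k).encard ≤ ∑ k ∈ s, (A k).encard := by
    intro s
    induction s using Finset.induction_on with
    | empty => simp
    | insert a s ha ih =>
      rw [Finset.set_biUnion_insert, Finset.sum_insert ha]
      exact (Set.encard_union_le _ _).trans (by gcongr)
  simpa using this Finset.univ

section WordSpans

variable [Fintype ι] [DecidableEq ι] {v : ∀ i j, S j ⟶ S i ⊗ X}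
  {Φ : (⨂[ℂ]^(n + 1) (ι → ℂ)) ≃ₗ[ℂ] (∀ i j, S j ⟶ leftPow (S i) X n)}

/-- A description of the span by vanishing components, from which invariance under postcomposition
and independence are immediate. -/
theorem mem_wordSpan_iff (hΦ : ∀ s, Φ (wordVec s) = treeFamily v n s) (i j : ι)
    (x : ⨂[ℂ]^(n + 1) (ι → ℂ)) :
    x ∈ wordSpan n i j ↔ ∀ i' j', (i', j') ≠ (i, j) → Φ x i' j' = 0 := by
  constructor
  · intro hx i' j' hij
    refine Submodule.span_induction (p := fun x _ => Φ x i' j' = 0) ?_ ?_ ?_ ?_ hx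
    · rintro _ ⟨s, rfl, rfl, rfl⟩
      rw [hΦ]
      by_cases hi : i' = s 0
      · exact treeFamily_of_ne_last v _ fun hj => hij (by rw [hi, hj])
      · exact treeFamily_of_ne_first v hi _
    · simp
    · intro x y _ _ hx hy
      rw [map_add, Pi.add_apply, Pi.add_apply, hx, hy, add_zero]
    · intro a x _ hx
      rw [map_smul, Pi.smul_apply, Pi.smul_apply, hx, smul_zero]
  · intro hx
    let r := (wordBasis ι (n + 1)).repr x
    have hxr : ∑ s, r s • wordVec s = x := by
      simpa only [wordBasis_apply] using (wordBasis ι (n + 1)).sum_repr x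
    let y := ∑ s, if s 0 = i ∧ s (Fin.last n) = j then r s • wordVec s else 0
    have hy : y ∈ wordSpan n i j := by
      refine Submodule.sum_mem _ fun s _ => ?_
      split_ifs with hs
      · exact Submodule.smul_mem _ _ (Submodule.subset_span ⟨s, hs.1, hs.2, rfl⟩)
      · exact Submodule.zero_mem _
    have hxy : x = y := by
      apply Φ.injective
      funext i' j'
      by_cases hij : (i', j') = (i, j)
      · obtain ⟨rfl, rfl⟩ := Prod.mk.inj hij
        simp only [← hxr, y, map_sum, Finset.sum_apply]
        refine Finset.sum_congr rfl fun s _ => ?_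
        split_ifs with hs
        · rfl
        · rw [map_smul, hΦ, map_zero]
          simp only [Pi.smul_apply, Pi.zero_apply]
          by_cases hi : i' = s 0
          · rw [treeFamily_of_ne_last v _ fun hj => hs ⟨hi.symm, hj.symm⟩, smul_zero]
          · rw [treeFamily_of_ne_first v hi, smul_zero]
      · rw [hx i' j' hij]
        simp only [y, map_sum, Finset.sum_apply]
        refine (Finset.sum_eq_zero fun s _ => ?_).symm
        split_ifs with hs
        · rw [map_smul, hΦ]
          simp only [Pi.smul_apply]
          by_cases hi : i' = s 0
          · rw [treeFamily_of_ne_last v _ fun hj => hij (by rw [hi, hj, hs.1, hs.2]), smul_zero]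
          · rw [treeFamily_of_ne_first v hi, smul_zero]
        · rw [map_zero]; rfl
    rw [hxy]
    exact hy

theorem isInternal_wordSpan (hΦ : ∀ s, Φ (wordVec s) = treeFamily v n s) :
    DirectSum.IsInternal (fun q : ι × ι => wordSpan n q.1 q.2) := by
  apply DirectSum.isInternal_submodule_of_iSupIndep_of_iSup_eq_top
  · rw [iSupIndep_def]
    rintro ⟨i, j⟩
    rw [Submodule.disjoint_def]
    intro x hx hx'
    let L : (⨂[ℂ]^(n + 1) (ι → ℂ)) →ₗ[ℂ] (S j ⟶ leftPow (S i) X n) :=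
      (LinearMap.proj j).comp ((LinearMap.proj i).comp Φ.toLinearMap)
    have hle : (⨆ q, ⨆ (_ : q ≠ (i, j)), wordSpan n q.1 q.2) ≤ LinearMap.ker L := by
      refine iSup₂_le fun q hq y hy => ?_
      exact (mem_wordSpan_iff hΦ q.1 q.2 y).1 hy i j (Ne.symm hq)
    have hL : Φ x i j = 0 := hle hx'
    apply Φ.injective
    rw [map_zero]
    funext i' j'
    by_cases hij : (i', j') = (i, j)
    · obtain ⟨rfl, rfl⟩ := Prod.mk.inj hij
      exact hL
    · exact (mem_wordSpan_iff hΦ i j x).1 hx i' j' hij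
  · rw [eq_top_iff, ← (wordBasis ι (n + 1)).span_eq, Submodule.span_le]
    rintro _ ⟨s, rfl⟩
    rw [wordBasis_apply]
    exact Submodule.mem_iSup_of_mem (s 0, s (Fin.last n))
      (Submodule.subset_span ⟨s, rfl, rfl, rfl⟩)

theorem representation_mem_wordSpan (hΦ : ∀ s, Φ (wordVec s) = treeFamily v n s)
    {ρ : Representation ℂ (BraidGroup n) (⨂[ℂ]^(n + 1) (ι → ℂ))}
    (hρ : ∀ (p : Fin (n - 1)) x i j,
      Φ (ρ (braidGen p) x) i j = Φ x i j ≫ stackBraid (S i) X n p.val) (i j : ι)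
    (g : BraidGroup n) (x : ⨂[ℂ]^(n + 1) (ι → ℂ)) (hx : x ∈ wordSpan n i j) :
    ρ g x ∈ wordSpan n i j := by
  obtain ⟨t, ht⟩ := exists_iso_of_representation hρ g
  rw [mem_wordSpan_iff hΦ] at hx ⊢
  intro i' j' hij
  rw [ht, hx i' j' hij, zero_comp]

theorem wordVec_ne_zero {N : ℕ} (s : Fin N → ι) : wordVec s ≠ 0 := by
  rw [← wordBasis_apply]
  exact (wordBasis ι N).ne_zero s

/-- Diagonal blocks are used because constant words make them nonzero for every `n`; when `n = 0`
the off-diagonal ones vanish. -/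
theorem not_isIrreducible_of_wordSpan
    (hint : DirectSum.IsInternal (fun q : ι × ι => wordSpan n q.1 q.2))
    {ρ : Representation ℂ (BraidGroup n) (⨂[ℂ]^(n + 1) (ι → ℂ))}
    (hinv : ∀ (i j : ι) (g : BraidGroup n), ∀ x ∈ wordSpan n i j, ρ g x ∈ wordSpan n i j)
    (hι : 2 ≤ Fintype.card ι) : ¬ ρ.IsIrreducible := by
  intro hirr
  obtain ⟨i, j, hij⟩ := Fintype.exists_pair_of_one_lt_card hι
  let U : Subrepresentation ρ := ⟨wordSpan n i i, fun g x hx => hinv i i g x hx⟩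
  have hmem : ∀ k : ι, wordVec (fun _ : Fin (n + 1) => k) ∈ wordSpan n k k := fun k =>
    Submodule.subset_span ⟨fun _ => k, rfl, rfl, rfl⟩
  have hdisj : Disjoint (wordSpan n i i) (wordSpan n j j) :=
    hint.submodule_iSupIndep.pairwiseDisjoint (i := (i, i)) (j := (j, j))
      (fun h => hij (Prod.mk.inj h).1)
  rcases hirr.eq_bot_or_eq_top U with h | h
  · have h1 : wordVec (fun _ : Fin (n + 1) => i) ∈ U := hmem i
    rw [h] at h1
    exact wordVec_ne_zero _ ((Submodule.mem_bot ℂ).1 h1)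
  · have h1 : wordVec (fun _ : Fin (n + 1) => j) ∈ U := by
      rw [h]
      exact Submodule.mem_top
    exact wordVec_ne_zero _ (Submodule.disjoint_def.1 hdisj _ h1 (hmem j))

end WordSpans

end Representation

/-! ### The F-matrix form of the blocks -/

section FMatrix

variable {C : Type u} [Category.{w} C] [Abelian C] [Linear ℂ C] [MonoidalCategory C]
  [MonoidalPreadditive C] [MonoidalLinear ℂ C] [RigidCategory C] [FusionCategory C]
  [BraidedCategory C]

theorem rightTree_comp_braidTop {A B D X : C} (f : D ⟶ A ⊗ B) (y : B ⟶ X ⊗ X) :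
    rightTree f y ≫ braidTop A X = rightTree f (y ≫ (β_ X X).hom) := by
  simp [rightTree, braidTop]

theorem rightTree_sum {A B D X : C} {σ : Type*} (t : Finset σ) (f : D ⟶ A ⊗ B) (r : σ → ℂ)
    (y : σ → (B ⟶ X ⊗ X)) :
    rightTree f (∑ k ∈ t, r k • y k) = ∑ k ∈ t, r k • rightTree f (y k) := by
  simp [rightTree, whiskerLeft_sum, Preadditive.comp_sum, Preadditive.sum_comp]

/-- On a right tree the braiding touches only the vertex in Hom(Y k, X ⊗ X); it preserves the
channel and the other vertex. -/
theorem toMatrix_braidTop_rightTree {κ : Type*} [Fintype κ] [DecidableEq κ] {Y : κ → C}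
    {A D X : C} {a c : κ → ℕ} (b : ∀ k, Module.Basis (Fin (a k)) ℂ (Y k ⟶ X ⊗ X))
    (f : ∀ k, Module.Basis (Fin (c k)) ℂ (D ⟶ A ⊗ Y k))
    (B : Module.Basis (Σ k, Fin (a k) × Fin (c k)) ℂ (D ⟶ (A ⊗ X) ⊗ X))
    (hB : ∀ q, B q = rightTree (f q.1 q.2.2) (b q.1 q.2.1)) :
    LinearMap.toMatrix B B (Linear.rightComp ℂ D (braidTop A X)) =
      Matrix.blockDiagonal' (fun k => LinearMap.toMatrix (b k) (b k) (braidingOp (Y k) X) ⊗ₖ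
        (1 : Matrix (Fin (c k)) (Fin (c k)) ℂ)) := by
  ext q ⟨k, r, t⟩
  have h : Linear.rightComp ℂ D (braidTop A X) (B ⟨k, r, t⟩) =
      ∑ r', LinearMap.toMatrix (b k) (b k) (braidingOp (Y k) X) r' r • B ⟨k, r', t⟩ := by
    simp only [Linear.rightComp_apply, hB, rightTree_comp_braidTop]
    refine Eq.trans ?_ (rightTree_sum Finset.univ (f k t)
      (fun r' => LinearMap.toMatrix (b k) (b k) (braidingOp (Y k) X) r' r) (b k))
    congr 1
    simp only [LinearMap.toMatrix_apply]
    exact ((b k).sum_repr _).symm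
  rw [LinearMap.toMatrix_apply, h]
  obtain ⟨l, r₁, t₁⟩ := q
  simp only [map_sum, map_smul, Module.Basis.repr_self, Finsupp.coe_finsetSum, Finset.sum_apply,
    Finsupp.smul_apply, smul_eq_mul, Finsupp.single_apply]
  by_cases hl : k = l
  · subst hl
    rw [Matrix.blockDiagonal'_apply_eq, Matrix.kroneckerMap_apply, Matrix.one_apply]
    by_cases ht : t = t₁
    · subst ht
      simp
    · simp [ht, Ne.symm ht]
  · rw [Matrix.blockDiagonal'_apply_ne _ _ _ (Ne.symm hl)]
    simp [hl]

theorem exists_FMatrix {ι κ : Type*} [Fintype ι] [DecidableEq ι] [Fintype κ] [DecidableEq κ]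
    {Y : κ → C} (hY : IsSimpleRepresentatives Y) {A D X : C} {a c : κ → ℕ}
    (b : ∀ k, Module.Basis (Fin (a k)) ℂ (Y k ⟶ X ⊗ X))
    (f : ∀ k, Module.Basis (Fin (c k)) ℂ (D ⟶ A ⊗ Y k))
    (L : Module.Basis ι ℂ (D ⟶ (A ⊗ X) ⊗ X)) :
    ∃ (F : Matrix (Σ k, Fin (a k) × Fin (c k)) ι ℂ)
      (G : Matrix ι (Σ k, Fin (a k) × Fin (c k)) ℂ),
      (∀ k, L k = ∑ q, F q k • rightTree (f q.1 q.2.2) (b q.1 q.2.1)) ∧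
      (∀ q, rightTree (f q.1 q.2.2) (b q.1 q.2.1) = ∑ k, G k q • L k) ∧
      F * G = 1 ∧ G * F = 1 ∧
      LinearMap.toMatrix L L (Linear.rightComp ℂ D (braidTop A X)) =
        G * Matrix.blockDiagonal' (fun k =>
          LinearMap.toMatrix (b k) (b k) (braidingOp (Y k) X) ⊗ₖ
            (1 : Matrix (Fin (c k)) (Fin (c k)) ℂ)) * F := by
  obtain ⟨B, hB⟩ := exists_rightTreeBasis hY A D X b f
  refine ⟨B.toMatrix L, L.toMatrix B, fun k => ?_, fun q => ?_, B.toMatrix_mul_toMatrix_flip L,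
    L.toMatrix_mul_toMatrix_flip B, ?_⟩
  · simp only [← hB]
    exact (B.sum_toMatrix_smul_self L k).symm
  · rw [← hB]
    exact (L.sum_toMatrix_smul_self B q).symm
  · rw [← toMatrix_braidTop_rightTree b f B hB]
    exact (basis_toMatrix_mul_linearMap_toMatrix_mul_basis_toMatrix L B L B _).symm

end FMatrix

/-! ### Transport of the relations to `R` -/

section BraidOperator

variable {C : Type u} [Category.{w} C] [Preadditive C] [Linear ℂ C] [MonoidalCategory C]
  [MonoidalPreadditive C] [MonoidalLinear ℂ C] [BraidedCategory C]
  {ι : Type*} [Fintype ι] [DecidableEq ι] {S : ι → C} {X : C}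

theorem intertwines_siteOp {v : ∀ i j, S j ⟶ S i ⊗ X} {M : ι → ι → Matrix ι ι ℂ}
    (hM : ∀ i k j, leftTree v i k j ≫ braidTop (S i) X = ∑ k', M i j k' k • leftTree v i k' j)
    {R : Module.End ℂ (⨂[ℂ]^3 (ι → ℂ))}
    (hR : ∀ i k j, R (wordVec ![i, k, j]) = ∑ k', M i j k' k • wordVec ![i, k', j]) {n : ℕ}
    {Φ : (⨂[ℂ]^(n + 1) (ι → ℂ)) ≃ₗ[ℂ] (∀ i j, S j ⟶ leftPow (S i) X n)}
    (hΦ : ∀ s, Φ (wordVec s) = treeFamily v n s) {p c : ℕ} (h : p + 3 + c = n + 1)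
    (x : ⨂[ℂ]^(n + 1) (ι → ℂ)) (i j : ι) :
    Φ (siteOp R p c h x) i j = Φ x i j ≫ stackBraid (S i) X n p := by
  have key : Φ.toLinearMap.comp (siteOp R p c h) =
      (stackEquiv S X n p).toLinearMap.comp Φ.toLinearMap := by
    refine (wordBasis ι (n + 1)).ext fun s => ?_
    rw [wordBasis_apply]
    simp only [LinearMap.comp_apply, LinearEquiv.coe_coe]
    funext i j
    rw [stackEquiv_apply, siteOp_wordVec hR h s, hΦ s,
      treeFamily_comp_stackBraid hM n p (by omega) s i j, map_sum]
    simp only [map_smul, hΦ, Finset.sum_apply, Pi.smul_apply]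
  have := congrFun (congrFun (LinearMap.congr_fun key x) i) j
  simpa only [LinearMap.comp_apply, LinearEquiv.coe_coe, stackEquiv_apply] using this

theorem exists_braidOperator {v : ∀ i j, S j ⟶ S i ⊗ X} {M : ι → ι → Matrix ι ι ℂ}
    (hM : ∀ i k j, leftTree v i k j ≫ braidTop (S i) X = ∑ k', M i j k' k • leftTree v i k' j)
    (Φ : (⨂[ℂ]^3 (ι → ℂ)) ≃ₗ[ℂ] (∀ i j, S j ⟶ leftPow (S i) X 2))
    (hΦ : ∀ s, Φ (wordVec s) = treeFamily v 2 s) :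
    ∃ R : (⨂[ℂ]^3 (ι → ℂ)) ≃ₗ[ℂ] (⨂[ℂ]^3 (ι → ℂ)),
      ∀ i k j, R (wordVec ![i, k, j]) = ∑ k', M i j k' k • wordVec ![i, k', j] := by
  -- `R` is the braiding of two strands conjugated by the tree isomorphism, so its invertibility is
  -- free.
  refine ⟨(Φ.trans (stackEquiv S X 2 0)).trans Φ.symm, fun i k j => ?_⟩
  rw [LinearEquiv.trans_apply, LinearEquiv.symm_apply_eq, LinearEquiv.trans_apply]
  funext i' j'
  rw [stackEquiv_apply, hΦ, treeFamily_comp_stackBraid hM 2 0 (by omega), map_sum]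
  simp only [map_smul, hΦ, Finset.sum_apply, Pi.smul_apply]
  refine Finset.sum_congr rfl fun k' _ => ?_
  have : Function.update ![i, k, j] ⟨0 + 1, by omega⟩ k' = ![i, k', j] := by
    funext q
    fin_cases q <;> rfl
  rw [this]
  rfl

theorem isGYBESolution_of_intertwines {R : (⨂[ℂ]^3 (ι → ℂ)) ≃ₗ[ℂ] (⨂[ℂ]^3 (ι → ℂ))}
    (Φ : (⨂[ℂ]^4 (ι → ℂ)) ≃ₗ[ℂ] (∀ i j, S j ⟶ leftPow (S i) X 3))
    (hR : ∀ (p c : ℕ) (h : p + 3 + c = 4) x i j,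
      Φ (siteOp R.toLinearMap p c h x) i j = Φ x i j ≫ stackBraid (S i) X 3 p) :
    IsGYBESolution (Fintype.card ι) 3 R := by
  refine ⟨inferInstance, by simp, ?_⟩
  refine LinearMap.ext fun x => Φ.injective ?_
  funext i j
  simp only [Module.End.mul_apply, hR, Category.assoc]
  rw [stackBraid_braid_relation _ _ 3 0 (by omega)]

theorem farCommutativity_of_intertwines {R : (⨂[ℂ]^3 (ι → ℂ)) ≃ₗ[ℂ] (⨂[ℂ]^3 (ι → ℂ))}
    (Φ : (⨂[ℂ]^5 (ι → ℂ)) ≃ₗ[ℂ] (∀ i j, S j ⟶ leftPow (S i) X 4))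
    (hR : ∀ (p c : ℕ) (h : p + 3 + c = 5) x i j,
      Φ (siteOp R.toLinearMap p c h x) i j = Φ x i j ≫ stackBraid (S i) X 4 p) :
    FarCommutativity 3 R := by
  intro j h1 h2
  obtain rfl : j = 3 := by omega
  refine LinearMap.ext fun x => Φ.injective ?_
  funext i j
  have h0 := hR 0 2 rfl
  have h2 := hR 2 0 rfl
  refine (h0 _ i j).trans (Eq.trans ?_ (h2 _ i j).symm)
  refine (congrArg (· ≫ _) (h2 _ i j)).trans (Eq.trans ?_ (congrArg (· ≫ _) (h0 _ i j)).symm)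
  simp only [Category.assoc]
  rw [stackBraid_far_commutativity _ _ 4 0 2 (by omega) (by omega)]

end BraidOperator

end GYBE

end

/-! ### The main theorem -/

theorem theorem1
    {C : Type u} [Category.{w} C] [Abelian C] [Linear ℂ C] [MonoidalCategory C]
    [MonoidalPreadditive C] [MonoidalLinear ℂ C] [RigidCategory C] [BraidedCategory C]
    [GYBE.FusionCategory C] [GYBE.RibbonStructure C]
    {ι : Type*} [Fintype ι] [DecidableEq ι] (d : ℕ) (hd : 0 < d) (X : C) (S : ι → C)
    (hX : GYBE.IsGYBEObject d X S)
    {κ : Type*} [Fintype κ] [DecidableEq κ] (Y : κ → C) (hY : GYBE.IsSimpleRepresentatives Y) :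
    -- the vertex spaces are one-dimensional
    (∀ i j, Module.finrank ℂ (S j ⟶ S i ⊗ X) = 1) ∧
    -- any choice of nonzero vertices gives the tree bases and the operator `R`
    (∀ v : ∀ i j, S j ⟶ S i ⊗ X, (∀ i j, v i j ≠ 0) →
      ∃ (R : (⨂[ℂ]^3 (ι → ℂ)) ≃ₗ[ℂ] (⨂[ℂ]^3 (ι → ℂ))) (M : ι → ι → Matrix ι ι ℂ),
        -- `R` is the direct sum of the blocks `M i j`
        (∀ i k j, R (GYBE.wordVec ![i, k, j]) =
          ∑ k', M i j k' k • GYBE.wordVec ![i, k', j]) ∧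
        -- `M i j` is the matrix of the braiding in the tree basis
        (∀ i k j, GYBE.leftTree v i k j ≫ GYBE.braidTop (S i) X =
          ∑ k', M i j k' k • GYBE.leftTree v i k' j) ∧
        -- `M i j` is the direct sum of the braidings on `Hom(Y_k, X ⊗ X)`, conjugated by the
        -- `F`-matrix that relates the two tree bases
        (∀ (a : κ → ℕ) (b : ∀ k, Module.Basis (Fin (a k)) ℂ (Y k ⟶ X ⊗ X)) (i j : ι)
          (c : κ → ℕ) (f : ∀ k, Module.Basis (Fin (c k)) ℂ (S j ⟶ S i ⊗ Y k)),
          ∃ (F : Matrix (Σ k, Fin (a k) × Fin (c k)) ι ℂ)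
            (G : Matrix ι (Σ k, Fin (a k) × Fin (c k)) ℂ),
            (∀ k, GYBE.leftTree v i k j =
              ∑ q, F q k • GYBE.rightTree (f q.1 q.2.2) (b q.1 q.2.1)) ∧
            (∀ q, GYBE.rightTree (f q.1 q.2.2) (b q.1 q.2.1) =
              ∑ k, G k q • GYBE.leftTree v i k j) ∧
            F * G = 1 ∧ G * F = 1 ∧
            M i j = G * Matrix.blockDiagonal' (fun k =>
              LinearMap.toMatrix (b k) (b k) (GYBE.braidingOp (Y k) X) ⊗ₖ
                (1 : Matrix (Fin (c k)) (Fin (c k)) ℂ)) * F) ∧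
        GYBE.IsGYBESolution d 3 R ∧
        GYBE.FarCommutativity 3 R ∧
        ∀ n : ℕ, ∃ ρ : Representation ℂ (GYBE.BraidGroup n) (⨂[ℂ]^(n + 1) (ι → ℂ)),
          (∀ p : Fin (n - 1), ρ (GYBE.braidGen p) =
            GYBE.siteOp R.toLinearMap p.val (n - 2 - p.val) (by omega)) ∧
          -- identification with the action of braids by stacking on `⊕ Hom(S j, S i ⊗ X^{⊗ n})`
          (∃ Φ : (⨂[ℂ]^(n + 1) (ι → ℂ)) ≃ₗ[ℂ] (∀ i j, S j ⟶ GYBE.leftPow (S i) X n),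
            (∀ s : Fin (n + 1) → ι, Φ (GYBE.wordVec s) =
              Pi.single (s 0) (Pi.single (s (Fin.last n)) (GYBE.wordTree v n s))) ∧
            ∀ (p : Fin (n - 1)) (x) (i j : ι), Φ (ρ (GYBE.braidGen p) x) i j =
              Φ x i j ≫ GYBE.stackBraid (S i) X n p.val) ∧
          -- the number of distinct eigenvalues of each braid generator
          (∀ p : Fin (n - 1), {z : ℂ | Module.End.HasEigenvalue (ρ (GYBE.braidGen p)) z}.encard ≤
            ((∑ k, Module.finrank ℂ (Y k ⟶ X ⊗ X) : ℕ) : ℕ∞)) ∧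
          -- the representation is the direct sum of subrepresentations indexed by `i, j`
          DirectSum.IsInternal (fun q : ι × ι => GYBE.wordSpan n q.1 q.2) ∧
          (∀ (i j : ι) (g : GYBE.BraidGroup n),
            ∀ x ∈ GYBE.wordSpan n i j, ρ g x ∈ GYBE.wordSpan n i j) ∧
          (2 ≤ d → ¬ ρ.IsIrreducible)) ∧
    -- the quantum dimension is an integer, and equals `d` unless it vanishes
    (∃ z : ℤ, GYBE.qdim X = z) ∧
    (GYBE.qdim X ≠ 0 → GYBE.qdim X = d) ∧
    (Simple X → GYBE.qdim X = d) ∧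
    ((∀ i, ∃ r : ℝ, 0 < r ∧ GYBE.qdim (S i) = r) → GYBE.qdim X = d) := by
  refine ⟨hX.finrank_vertex, fun v hv => ?_, ?_⟩
  · obtain ⟨w, hvw, hwv⟩ := hX.exists_dual_vertices hv
    choose T hT using GYBE.exists_treeBasis hX.simple hX.distinct hvw hwv
    choose L hL using GYBE.exists_leftTreeBasis hX.finrank_vertex hv hvw hwv
    -- The tree isomorphism matches the two bases indexed by words of length `n + 1`.
    let Φ := fun n => (GYBE.wordBasis ι (n + 1)).equiv (T n) (Equiv.refl _)
    have hΦ : ∀ n s, Φ n (GYBE.wordVec s) = GYBE.treeFamily v n s := fun n s => by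
      rw [← GYBE.wordBasis_apply, Module.Basis.equiv_apply, hT, Equiv.refl_apply]
    let M : ι → ι → Matrix ι ι ℂ := fun i j =>
      LinearMap.toMatrix (L i j) (L i j) (Linear.rightComp ℂ (S j) (GYBE.braidTop (S i) X))
    have hM : ∀ i k j, GYBE.leftTree v i k j ≫ GYBE.braidTop (S i) X =
        ∑ k', M i j k' k • GYBE.leftTree v i k' j := by
      intro i k j
      simp only [M, LinearMap.toMatrix_apply, ← hL]
      exact ((L i j).sum_repr _).symm
    obtain ⟨R, hR⟩ := GYBE.exists_braidOperator hM (Φ 2) (hΦ 2)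
    have hsite : ∀ {n p c : ℕ} (h : p + 3 + c = n + 1) x i j,
        Φ n (GYBE.siteOp R.toLinearMap p c h x) i j = Φ n x i j ≫ GYBE.stackBraid (S i) X n p :=
      fun {n} _ _ h => GYBE.intertwines_siteOp hM hR (hΦ n) h
    refine ⟨R, M, hR, hM, fun a b i j c f => ?_, ?_, ?_, fun n => ?_⟩
    · simpa only [hL] using GYBE.exists_FMatrix hY b f (L i j)
    · rw [← hX.card_eq]
      exact GYBE.isGYBESolution_of_intertwines (Φ 3) fun _ _ h => hsite h
    · exact GYBE.farCommutativity_of_intertwines (Φ 4) fun _ _ h => hsite h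
    · obtain ⟨ρ, hρ⟩ := GYBE.exists_braidGroup_representation (Φ n)
      have hint := GYBE.isInternal_wordSpan (hΦ n)
      have hinv := GYBE.representation_mem_wordSpan (hΦ n) hρ
      refine ⟨ρ, fun p => ?_, ⟨Φ n, hΦ n, hρ⟩, fun p => ?_, hint, hinv, fun h2 => ?_⟩
      · refine LinearMap.ext fun x => (Φ n).injective ?_
        funext i j
        rw [hρ, hsite]
      · have hfin := fun k => GYBE.finiteDimensional_hom (Y k) (X ⊗ X)
        have hsub : {z : ℂ | Module.End.HasEigenvalue (ρ (GYBE.braidGen p)) z} ⊆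
            ⋃ k, {z : ℂ | (GYBE.braidingOp (Y k) X).HasEigenvalue z} := fun z hz =>
          Set.mem_iUnion.2 (GYBE.hasEigenvalue_comp_of_representation hY (by omega) (hρ p) hz)
        refine (Set.encard_le_encard hsub).trans ((GYBE.encard_iUnion_le_sum _).trans ?_)
        rw [Nat.cast_sum]
        exact Finset.sum_le_sum fun k _ => GYBE.encard_hasEigenvalue_le _
      · exact GYBE.not_isIrreducible_of_wordSpan hint hinv (hX.card_eq ▸ h2)
  · refine ⟨?_, hX.qdim_eq_of_ne_zero hd, fun _ => ?_, fun h => ?_⟩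
    -- The only possible values are 0 and `d`.
    · by_cases h : GYBE.qdim X = 0
      · exact ⟨0, by simp [h]⟩
      · exact ⟨d, by simp [hX.qdim_eq_of_ne_zero hd h]⟩
    · exact hX.qdim_eq_of_ne_zero hd (GYBE.qdim_ne_zero_of_simple X)
    · exact hX.qdim_eq_of_ne_zero hd (hX.qdim_ne_zero_of_pos hd h)
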